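/- **Theorem 3.1.** Let $E$ be a countable set with a metric $d$. Let $(X_t)_{t\ge 0}$ be an $E$-valued regular (totally stable, conservative), non-explosive, continuous-time homogeneous Markov chain. Let $Q(x,y)\ge 0$ ($x\ne y$) be its transition rates, so that its generator on bounded functions is $\mathcal L f(x)=\sum_{y\in E}(f(y)-f(x))Q(x,y)$. Write $\mathbb P_x,\mathbb E_x$ for probability and expectation when $X_0=x$, and $P_tf(x)=\mathbb E_x[f(X_t)]$. For $f:E\to\mathbb R$ put $\|f\|_{\mathrm{Lip}_d}=\sup_{x\ne y}|f(x)-f(y)|/d(x,y)$, and let $\mathrm{Lip}_d(E)$ be the set of $f$ for which this is finite. Let $b>0$, $V>0$, $K\in\mathbb R$, and assume: 1. (jumps bounded by $b$) for every $x\in E$, $\mathbb P_x$-almost surely, $\sup_{t>0}d(X_{t-},X_t)\le b$; 2. (angle bracket bounded by $V^2$) $\sum_{y\in E}d(x,y)^2Q(x,y)\le V^2$ for every $x\in E$; 3. ($d$-Wasserstein curvature bounded below by $K$) for every $t>0$ there are $x,z\in E$ with $\mathbb E_x[d(X_t,z)]<\infty$, and $\inf_{t>0}K_t\ge K$, where $$K_t=-\frac1t\sup\Big\{\log\frac{\|P_tf\|_{\mathrm{Lip}_d}}{\|f\|_{\mathrm{Lip}_d}}: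 f\in \mathrm{Lip}_d(E),\ f\ne\text{const}\Big\}.$$ Equivalently, $\|P_tf\|_{\mathrm{Lip}_d}\le e^{-Kt}\|f\|_{\mathrm{Lip}_d}$ for all $t>0$ and all $f\in\mathrm{Lip}_d(E)$. Let $C_{t,K}=\sup_{0\le s\le t}e^{-K(t-s)}$, and let $M_{t,K}=(1-e^{-2Kt})/(2K)$ if $K\ne0$ and $M_{t,0}=t$. Then for every $f\in\mathrm{Lip}_d(E)$, $x\in E$, $t>0$ and $y>0$, the variable $f(X_t)$ is $\mathbb P_x$-integrable and $$\mathbb P_x\big(f(X_t)-\mathbb E_x[f(X_t)]\ge y\big)\le\exp\left(-\frac{y}{2bC_{t,K}\|f\|_{\mathrm{Lip}_d}}\log\Big(1+\frac{bC_{t,K}\,y}{M_{t,K}V^2\|f\|_{\mathrm{Lip}_d}}\Big)\right),$$ where the right-hand side is read as $0$ if $\|f\|_{\mathrm{Lip}_d}=0$. -/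

import Mathlib

open MeasureTheory Filter Topology
open scoped NNReal ENNReal

noncomputable section

/-- The Lipschitz seminorm `sup_{x ≠ y} |f x - f y| / d(x, y)`, with values in `[0, ∞]`. -/
def lipSeminorm {E : Type*} [MetricSpace E] (f : E → ℝ) : ℝ≥0∞ :=
  ⨆ (x : E) (y : E) (_ : x ≠ y), ENNReal.ofReal (|f x - f y| / dist x y)

/-- `f` belongs to the space of `d`-Lipschitz functions. -/
def IsLip {E : Type*} [MetricSpace E] (f : E → ℝ) : Prop :=
  lipSeminorm f < ⊤

/-- `z` is the value just before time `t` of the path `w`: the path is constant, equal to `z`,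
on some interval to the left of `t` (left limit in the discrete topology). -/
def IsLeftValue {E : Type*} (w : ℝ≥0 → E) (t : ℝ≥0) (z : E) : Prop :=
  ∀ᶠ s in 𝓝[<] t, w s = z

/-- Right-continuous step paths with left limits (for the discrete topology on `E`); equivalently,
right-continuous step paths with finitely many jumps on every bounded time interval. -/
def IsStepPath {E : Type*} (w : ℝ≥0 → E) : Prop :=
  (∀ t, ∀ᶠ s in 𝓝[>] t, w s = w t) ∧ ∀ t, 0 < t → ∃ z, IsLeftValue w t z

/-- A regular (totally stable and conservative), non-explosive continuous-time homogeneous Markov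
chain on the countable set `E`: a process on a filtered space with a family `law x` of probability
measures (the process started at `x`), with transition rates `rate x y` for `x ≠ y`.
The diagonal values `rate x x` play no role. -/
structure RegularMarkovChain (E Ω : Type*) [MeasurableSpace E] [mΩ : MeasurableSpace Ω] where
  /-- The filtration. -/
  filt : Filtration ℝ≥0 mΩ
  /-- The process. -/
  X : ℝ≥0 → Ω → E
  /-- The probability measure under which the chain starts at `x`. -/
  law : E → Measure Ω
  /-- The transition rates. -/
  rate : E → E → ℝ
  isProbabilityMeasure_law : ∀ x, IsProbabilityMeasure (law x)
  adapted : ∀ t, Measurable[filt t] (X t)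
  start : ∀ x, ∀ᵐ ω ∂(law x), X 0 ω = x
  /-- Non-explosion: almost surely the path is a step path on the whole half-line. -/
  stepPath : ∀ x, ∀ᵐ ω ∂(law x), IsStepPath fun t => X t ω
  /-- The homogeneous Markov property: given the past up to time `s`, the conditional probability
  of `X (s + t) = y` is the probability of `X t = y` for the chain started at `X s`. -/
  markov : ∀ (x : E) (s t : ℝ≥0) (y : E) (A : Set Ω), MeasurableSet[filt s] A →
    law x (A ∩ {ω | X (s + t) ω = y}) = ∫⁻ ω in A, law (X s ω) {ω' | X t ω' = y} ∂(law x)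
  rate_nonneg : ∀ x y, x ≠ y → 0 ≤ rate x y
  /-- Total stability: the total rate of leaving each state is finite. -/
  rate_summable : ∀ x, Summable fun y => rate x y
  /-- The generator on bounded functions is `f ↦ ∑ y, (f y - f x) * rate x y`. -/
  generator : ∀ f : E → ℝ, (∃ c, ∀ x, |f x| ≤ c) → ∀ x,
    Tendsto (fun t : ℝ≥0 => ((∫ ω, f (X t ω) ∂(law x)) - f x) / (t : ℝ)) (𝓝[>] 0)
      (𝓝 (∑' y, (f y - f x) * rate x y))

namespace RegularMarkovChain

variable {E Ω : Type*} [MetricSpace E] [MeasurableSpace E] [MeasurableSpace Ω]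
  (𝒳 : RegularMarkovChain E Ω)

/-- The semigroup `P_t f (x) = E_x[f(X_t)]`. -/
def semigroup (t : ℝ≥0) (f : E → ℝ) (x : E) : ℝ :=
  ∫ ω, f (𝒳.X t ω) ∂(𝒳.law x)

/-- The transition probability `P_t(x, ·)` has a finite first moment. -/
def HasFirstMoment (t : ℝ≥0) (x : E) : Prop :=
  ∃ z : E, Integrable (fun ω => dist (𝒳.X t ω) z) (𝒳.law x)

/-- The jumps of the chain are bounded by `b`: `sup_{t > 0} d(X_{t-}, X_t) ≤ b` almost surely,
for every starting point. -/
def JumpsBoundedBy (b : ℝ) : Prop :=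
  ∀ x, ∀ᵐ ω ∂(𝒳.law x), ∀ t, 0 < t → ∀ z, IsLeftValue (fun s => 𝒳.X s ω) t z →
    dist z (𝒳.X t ω) ≤ b

/-- The angle bracket is bounded by `a`: `∑ y, d(x, y)² Q(x, y) ≤ a` for all `x`. -/
def AngleBracketBoundedBy (a : ℝ) : Prop :=
  ∀ x, (Summable fun y => dist x y ^ 2 * 𝒳.rate x y) ∧
    ∑' y, dist x y ^ 2 * 𝒳.rate x y ≤ a

/-- The Wasserstein curvature at time `t > 0`,
`-(1/t) sup { log (‖P_t f‖_Lip / ‖f‖_Lip) : f Lipschitz and not constant }`,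
where `log 0 = -∞` and `log ∞ = ∞`. -/
def wassersteinCurvature (t : ℝ≥0) : EReal :=
  -(((1 / (t : ℝ) : ℝ) : EReal) *
    ⨆ (f : E → ℝ) (_ : IsLip f ∧ ¬ ∃ c, ∀ x, f x = c),
      ENNReal.log (lipSeminorm (𝒳.semigroup t f) / lipSeminorm f))

/-- The Wasserstein curvature is bounded below by `K`. The first part is the standing condition
under which the curvature is defined. -/
def WassersteinCurvatureBoundedBelow (K : ℝ) : Prop :=
  (∀ t : ℝ≥0, 0 < t → ∃ x, 𝒳.HasFirstMoment t x) ∧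
    (K : EReal) ≤ ⨅ (t : ℝ≥0) (_ : 0 < t), 𝒳.wassersteinCurvature t

end RegularMarkovChain

/-- `C_{t,K} = sup_{0 ≤ s ≤ t} exp (-K (t - s))`. -/
def curvC (t K : ℝ) : ℝ :=
  ⨆ s : Set.Icc (0 : ℝ) t, Real.exp (-K * (t - s))

/-- `M_{t,K} = (1 - exp (-2 K t)) / (2 K)`, and `M_{t,0} = t`. -/
def curvM (t K : ℝ) : ℝ :=
  if K = 0 then t else (1 - Real.exp (-2 * K * t)) / (2 * K)

end

/-! The proof follows the semigroup `P_r f` instead of a martingale. For a bounded Lipschitz `f` and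
`a > 0`, put `H r = exp (a * P_r f + c * M_{r,K})`. Since `P_r f` solves the backward equation,

  `𝓛 (exp (a g)) (x) = exp (a g(x)) * (a * 𝓛 g (x) + ∑ y, (exp Δ - 1 - Δ) * Q(x, y))`,
  with `g = P_r f` and `Δ = a * (g y - g x)`,

and the sum is controlled by three facts: `P_r f` is Lipschitz with constant
`exp (-K r) * ‖f‖_Lip` by the curvature assumption, only states with `d(x, y) ≤ b` have a positive
rate (`rate_eq_zero_of_lt_dist`), and the angle bracket is at most `V ^ 2` (`gen_exp_le`). With the
right constant `c` this gives `∂_r H ≥ 𝓛 H`, hence `P_t (exp (a f)) ≤ H t` (`semigroup_exp_le`), a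
bound of Bennett type on the exponential moments of `f (X_t) - P_t f`. Truncation, Fatou's lemma and
Chernoff's bound with the optimal `a` finish the proof.

The total jump rates may be unbounded, so `∂_r H ≥ 𝓛 H` does not by itself give `P_t (H 0) ≤ H t`.
The comparison principle `semigroup_le_of_locally_le` supplies this: the short-time expansion
`P_h φ = φ + h 𝓛 φ + o(h)`, whose remainder is uniform in `φ` of a given bound but not in the state,
is iterated along a fine grid while the chain stays in a finite set, and a step path stays in a
finite set up to time `t`.

That long jumps have rate zero is also read off on grids: if `Q(x, y) > 0`, then with a probability
bounded below the chain goes from `x` to `y` in one step of the grid, on infinitely many grids of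
vanishing mesh, and a step path for which this happens has a jump from `x` to `y`. -/

namespace RegularMarkovChain

variable {E Ω : Type*} [MeasurableSpace E] [MeasurableSpace Ω] (𝒳 : RegularMarkovChain E Ω)

/-! ### The transition semigroup on bounded functions -/

instance (x : E) : IsProbabilityMeasure (𝒳.law x) := 𝒳.isProbabilityMeasure_law x

theorem measurable_X (t : ℝ≥0) : Measurable (𝒳.X t) :=
  (𝒳.adapted t).mono (𝒳.filt.le t) le_rfl

/-- The transition kernel `P_t(x, ·)`. -/
noncomputable def kernel [DiscreteMeasurableSpace E] (t : ℝ≥0) : ProbabilityTheory.Kernel E E where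
  toFun x := (𝒳.law x).map (𝒳.X t)
  measurable' := Measurable.of_discrete

theorem semigroup_eq_integral_kernel [DiscreteMeasurableSpace E] (t : ℝ≥0) (φ : E → ℝ) (x : E) :
    𝒳.semigroup t φ x = ∫ y, φ y ∂(𝒳.kernel t x) :=
  (integral_map (𝒳.measurable_X t).aemeasurable
    (Measurable.of_discrete).aestronglyMeasurable).symm

theorem integrable_of_bounded [DiscreteMeasurableSpace E] {φ : E → ℝ} {B : ℝ}
    (hφ : ∀ y, |φ y| ≤ B) (t : ℝ≥0) (x : E) :
    Integrable (fun ω => φ (𝒳.X t ω)) (𝒳.law x) :=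
  Integrable.of_bound
    ((Measurable.of_discrete (f := φ)).comp (𝒳.measurable_X t)).aestronglyMeasurable B
    (ae_of_all _ fun _ => hφ _)

theorem abs_semigroup_le {φ : E → ℝ} {B : ℝ} (hφ : ∀ y, |φ y| ≤ B) (t : ℝ≥0) (x : E) :
    |𝒳.semigroup t φ x| ≤ B := by
  have := norm_integral_le_of_norm_le_const (μ := 𝒳.law x) (f := fun ω => φ (𝒳.X t ω))
    (C := B) (ae_of_all _ fun ω => hφ _)
  simpa [semigroup] using this

theorem semigroup_zero (φ : E → ℝ) (x : E) : 𝒳.semigroup 0 φ x = φ x := by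
  have : (fun ω => φ (𝒳.X 0 ω)) =ᵐ[𝒳.law x] fun _ => φ x := by
    filter_upwards [𝒳.start x] with ω h
    rw [h]
  rw [semigroup, integral_congr_ae this]
  simp

theorem map_restrict_X_add [DiscreteMeasurableSpace E] [Countable E] (x : E) (s t : ℝ≥0)
    {A : Set Ω} (hA : MeasurableSet[𝒳.filt s] A) :
    ((𝒳.law x).restrict A).map (𝒳.X (s + t)) =
      (((𝒳.law x).restrict A).map (𝒳.X s)).bind (𝒳.kernel t) := by
  refine Measure.ext_of_singleton fun y => ?_
  have hy : MeasurableSet ({y} : Set E) := MeasurableSet.singleton y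
  rw [Measure.bind_apply hy (𝒳.kernel t).measurable.aemeasurable,
    lintegral_map Measurable.of_discrete (𝒳.measurable_X s),
    Measure.map_apply (𝒳.measurable_X _) hy,
    Measure.restrict_apply (𝒳.measurable_X _ hy), Set.inter_comm]
  refine (𝒳.markov x s t y A hA).trans (lintegral_congr fun ω => ?_)
  exact (Measure.map_apply (𝒳.measurable_X t) hy).symm

/-- The Markov property for a bounded function of the state at a later time. -/
theorem setIntegral_X_add [DiscreteMeasurableSpace E] [Countable E] {φ : E → ℝ} {B : ℝ}
    (hφ : ∀ y, |φ y| ≤ B) (x : E) (s t : ℝ≥0) {A : Set Ω} (hA : MeasurableSet[𝒳.filt s] A) :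
    ∫ ω in A, φ (𝒳.X (s + t) ω) ∂(𝒳.law x) =
      ∫ ω in A, 𝒳.semigroup t φ (𝒳.X s ω) ∂(𝒳.law x) := by
  have hm {g : E → ℝ} {μ : Measure E} : AEStronglyMeasurable g μ :=
    (Measurable.of_discrete).aestronglyMeasurable
  have key := 𝒳.map_restrict_X_add x s t hA
  rw [← integral_map (𝒳.measurable_X (s + t)).aemeasurable (f := φ) hm,
    ← integral_map (𝒳.measurable_X s).aemeasurable (f := 𝒳.semigroup t φ) hm]
  have hint : Integrable φ (((𝒳.law x).restrict A).map (𝒳.X (s + t))) :=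
    Integrable.of_bound hm B (ae_of_all _ hφ)
  rw [key] at hint ⊢
  have := ProbabilityTheory.Kernel.integral_comp (η := 𝒳.kernel t)
    (κ := ProbabilityTheory.Kernel.const Unit (((𝒳.law x).restrict A).map (𝒳.X s))) (a := ())
    (f := φ) (by simpa [ProbabilityTheory.Kernel.comp_apply] using hint)
  simp_rw [semigroup_eq_integral_kernel]
  simpa [ProbabilityTheory.Kernel.comp_apply] using this

theorem semigroup_add [DiscreteMeasurableSpace E] [Countable E] {φ : E → ℝ} {B : ℝ}
    (hφ : ∀ y, |φ y| ≤ B) (s t : ℝ≥0) (x : E) :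
    𝒳.semigroup (s + t) φ x = 𝒳.semigroup s (𝒳.semigroup t φ) x := by
  simpa [semigroup] using 𝒳.setIntegral_X_add hφ x s t (A := Set.univ) MeasurableSet.univ

end RegularMarkovChain

/-! ### Step paths -/

/-- Around every time, a step path takes one value strictly before it and one value from it on. -/
theorem IsStepPath.eventually_nhds {E : Type*} {w : ℝ≥0 → E} (hw : IsStepPath w) (s : ℝ≥0) :
    ∃ z, ∀ᶠ r in 𝓝 s, (r < s → w r = z) ∧ (s ≤ r → w r = w s) := by
  have hright : ∀ᶠ r in 𝓝 s, s ≤ r → w r = w s := by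
    filter_upwards [eventually_nhdsWithin_iff.1 (hw.1 s)] with r hr hsr
    rcases hsr.eq_or_lt with rfl | h
    · rfl
    · exact hr h
  rcases eq_zero_or_pos s with rfl | hs
  · exact ⟨w 0, hright.mono fun r hr => ⟨fun h => absurd h not_lt_zero, hr⟩⟩
  · obtain ⟨z, hz⟩ := hw.2 s hs
    exact ⟨z, (eventually_nhdsWithin_iff.1 hz).and hright⟩

theorem IsStepPath.finite_image_Icc {E : Type*} {w : ℝ≥0 → E} (hw : IsStepPath w) (t : ℝ≥0) :
    (w '' Set.Icc 0 t).Finite := by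
  refine (isCompact_Icc (a := (0 : ℝ≥0)) (b := t)).induction_on
    (p := fun S => (w '' S).Finite) (by simp) (fun S T h hT => hT.subset (Set.image_mono h))
    (fun S T hS hT => by rw [Set.image_union]; exact hS.union hT) fun s _ => ?_
  obtain ⟨z, hz⟩ := hw.eventually_nhds s
  refine ⟨_, mem_nhdsWithin_of_mem_nhds hz, (Set.toFinite {z, w s}).subset ?_⟩
  rintro _ ⟨r, hr, rfl⟩
  rcases lt_or_ge r s with h | h
  · exact Or.inl (hr.1 h)
  · exact Or.inr (hr.2 h)

namespace RegularMarkovChain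

variable {E Ω : Type*} [MeasurableSpace E] [MeasurableSpace Ω] (𝒳 : RegularMarkovChain E Ω)

/-! ### A comparison principle for nonexplosive chains -/

/-- The event that the chain is in `A` at the first `k` times `0, h, 2h, …` of a grid. -/
def gridStay (A : Set E) (h : ℝ≥0) (k : ℕ) : Set Ω :=
  {ω | ∀ j < k, 𝒳.X (j * h) ω ∈ A}

theorem gridStay_zero (A : Set E) (h : ℝ≥0) : 𝒳.gridStay A h 0 = Set.univ := by
  simp [gridStay]

theorem gridStay_succ (A : Set E) (h : ℝ≥0) (k : ℕ) :
    𝒳.gridStay A h (k + 1) = 𝒳.gridStay A h k ∩ {ω | 𝒳.X (k * h) ω ∈ A} := by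
  ext ω
  simp only [gridStay, Nat.forall_lt_succ_right, Set.mem_ofPred_eq, Set.mem_inter_iff]

theorem measurableSet_gridStay_succ [DiscreteMeasurableSpace E] (A : Set E) (h : ℝ≥0) (k : ℕ) :
    MeasurableSet[𝒳.filt (k * h)] (𝒳.gridStay A h (k + 1)) := by
  have : 𝒳.gridStay A h (k + 1) = ⋂ j ∈ Set.Iio (k + 1), {ω | 𝒳.X (j * h) ω ∈ A} := by
    ext ω
    simp [gridStay]
  rw [this]
  refine MeasurableSet.biInter (Set.to_countable _) fun j hj => ?_
  refine 𝒳.filt.mono ?_ _ (𝒳.adapted (j * h) (MeasurableSet.of_discrete (s := A)))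
  gcongr
  exact Nat.lt_succ_iff.1 hj

theorem measurableSet_gridStay [DiscreteMeasurableSpace E] (A : Set E) (h : ℝ≥0) (k : ℕ) :
    MeasurableSet (𝒳.gridStay A h k) := by
  rcases k with _ | k
  · simp [gridStay_zero]
  · exact 𝒳.filt.le _ _ (𝒳.measurableSet_gridStay_succ A h k)

theorem setIntegral_gridStay_le [DiscreteMeasurableSpace E] [Countable E] {H : ℝ≥0 → E → ℝ}
    {B ε : ℝ} (hε : 0 ≤ ε) (A : Set E) (h : ℝ≥0) (N : ℕ)
    (hH0 : ∀ r ≤ N * h, ∀ y, 0 ≤ H r y) (hHB : ∀ r ≤ N * h, ∀ y, H r y ≤ B)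
    (hloc : ∀ y ∈ A, ∀ r, r + h ≤ N * h → 𝒳.semigroup h (H r) y ≤ H (r + h) y + ε * h) (x : E) :
    ∫ ω in 𝒳.gridStay A h N, H 0 (𝒳.X (N * h) ω) ∂(𝒳.law x) ≤ H (N * h) x + N * (ε * h) := by
  have habs : ∀ r ≤ N * h, ∀ y, |H r y| ≤ B := fun r hr y => by
    rw [abs_of_nonneg (hH0 r hr y)]
    exact hHB r hr y
  have hle : ∀ m ≤ N, (m : ℝ≥0) * h ≤ N * h := fun m hm => by gcongr
  suffices key : ∀ k ≤ N, ∫ ω in 𝒳.gridStay A h k, H ((N - k : ℕ) * h) (𝒳.X (k * h) ω) ∂(𝒳.law x)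
      ≤ H (N * h) x + k * (ε * h) by
    simpa using key N le_rfl
  intro k
  induction k with
  | zero =>
    intro _
    have := 𝒳.semigroup_zero (H (N * h)) x
    simp only [semigroup] at this
    simp [gridStay_zero, this]
  | succ k ih =>
    intro hk
    obtain ⟨m, rfl⟩ : ∃ m, N = m + 1 + k := ⟨N - (k + 1), by omega⟩
    have e1 : m + 1 + k - (k + 1) = m := by omega
    have e2 : m + 1 + k - k = m + 1 := by omega
    have e3 : ((k + 1 : ℕ) : ℝ≥0) * h = k * h + h := by push_cast; ring
    have e4 : ((m + 1 : ℕ) : ℝ≥0) * h = m * h + h := by push_cast; ring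
    have hm := hle m (by omega)
    have hm1 := hle (m + 1) (by omega)
    have ih := ih (by omega)
    rw [e2] at ih
    rw [e1, e3, 𝒳.setIntegral_X_add (habs _ hm) x _ _ (𝒳.measurableSet_gridStay_succ A h k)]
    have hmeas := 𝒳.measurableSet_gridStay A h (k + 1)
    have hint := 𝒳.integrable_of_bounded (habs _ hm1) (k * h) x
    have hεh : 0 ≤ ε * h := by positivity
    calc ∫ ω in 𝒳.gridStay A h (k + 1), 𝒳.semigroup h (H (m * h)) (𝒳.X (k * h) ω) ∂(𝒳.law x)
        ≤ ∫ ω in 𝒳.gridStay A h (k + 1),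
            (H ((m + 1 : ℕ) * h) (𝒳.X (k * h) ω) + ε * h) ∂(𝒳.law x) := by
          refine setIntegral_mono_on
            (𝒳.integrable_of_bounded (𝒳.abs_semigroup_le (habs _ hm) h) _ _).integrableOn
            (hint.integrableOn.add (integrable_const _)) hmeas fun ω hω => ?_
          rw [e4] at hm1 ⊢
          exact hloc _ (hω k (Nat.lt_succ_self k)) _ hm1
      _ = ∫ ω in 𝒳.gridStay A h (k + 1), H ((m + 1 : ℕ) * h) (𝒳.X (k * h) ω) ∂(𝒳.law x)
            + (𝒳.law x).real (𝒳.gridStay A h (k + 1)) * (ε * h) := by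
          rw [integral_add hint.integrableOn (integrable_const _)]
          simp
      _ ≤ ∫ ω in 𝒳.gridStay A h k, H ((m + 1 : ℕ) * h) (𝒳.X (k * h) ω) ∂(𝒳.law x)
            + 1 * (ε * h) := by
          gcongr ?_ + ?_ * _
          · refine setIntegral_mono_set hint.integrableOn (ae_of_all _ fun ω => hH0 _ hm1 _) ?_
            refine LE.le.eventuallyLE ?_
            rw [gridStay_succ]
            exact Set.inter_subset_left
          · exact measureReal_le_one
      _ ≤ _ := by
          rw [Nat.cast_succ k]
          linarith

theorem tendsto_div_nat_succ_nhdsGT {t : ℝ≥0} (ht : 0 < t) :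
    Tendsto (fun n : ℕ => t / ((n + 1 : ℕ) : ℝ≥0)) atTop (𝓝[>] 0) := by
  refine tendsto_nhdsWithin_iff.2 ⟨?_, Eventually.of_forall fun n => ?_⟩
  · have h : Tendsto (fun n : ℕ => t / (n : ℝ≥0)) atTop (𝓝 0) := by
      rw [← NNReal.tendsto_coe]
      simpa using tendsto_const_div_atTop_nhds_zero_nat (t : ℝ)
    exact h.comp (tendsto_add_atTop_nat 1)
  · exact div_pos ht (by positivity)

/-- **Comparison principle.** If `H` is nonnegative and bounded, and satisfies
`∂_r H ≥ 𝓛 H` in the sense that `P_h (H r) ≤ H (r + h) + o(h)`, uniformly in `r` but with a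
remainder that may depend on the state, then `P_t (H 0) ≤ H t`.

The remainder is uniform on finite sets, so the inequality can be iterated along a fine grid as
long as the chain stays in a finite set. A step path visits only finitely many states before
time `t`, and this is where non-explosion enters. -/
theorem semigroup_le_of_locally_le [DiscreteMeasurableSpace E] [Countable E] {H : ℝ≥0 → E → ℝ}
    {B : ℝ} {t : ℝ≥0} (ht : 0 < t) (hH0 : ∀ r ≤ t, ∀ y, 0 ≤ H r y) (hHB : ∀ r ≤ t, ∀ y, H r y ≤ B)
    (hloc : ∀ y, ∀ ε > 0, ∀ᶠ h in 𝓝[>] (0 : ℝ≥0), ∀ r, r + h ≤ t →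
      𝒳.semigroup h (H r) y ≤ H (r + h) y + ε * h) (x : E) :
    𝒳.semigroup t (H 0) x ≤ H t x := by
  have hint : Integrable (fun ω => H 0 (𝒳.X t ω)) (𝒳.law x) :=
    𝒳.integrable_of_bounded (B := B) (fun y => by
      rw [abs_of_nonneg (hH0 0 zero_le y)]
      exact hHB 0 zero_le y) t x
  have hgrid (n : ℕ) : ((n + 1 : ℕ) : ℝ≥0) * (t / ((n + 1 : ℕ) : ℝ≥0)) = t :=
    mul_div_cancel₀ t (by positivity)
  obtain ⟨e, he⟩ := exists_injective_nat E
  -- the chain stays among the first `m` states at all times of all the grids `t / (n + 1)`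
  let G : ℕ → Set Ω := fun m => ⋂ n : ℕ, 𝒳.gridStay {y | e y ≤ m} (t / ((n + 1 : ℕ) : ℝ≥0)) (n + 1)
  have hGmeas : ∀ m, MeasurableSet (G m) := fun m =>
    MeasurableSet.iInter fun n => 𝒳.measurableSet_gridStay _ _ _
  have hGmono : Monotone G := fun m m' hm => Set.iInter_mono fun n ω hω j hj => (hω j hj).trans hm
  have hG (m : ℕ) : ∫ ω in G m, H 0 (𝒳.X t ω) ∂(𝒳.law x) ≤ H t x := by
    have hfin : {y | e y ≤ m}.Finite := (Set.finite_Iic m).preimage he.injOn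
    refine le_of_forall_pos_le_add fun δ hδ => ?_
    have hev : ∀ᶠ h in 𝓝[>] (0 : ℝ≥0), ∀ y ∈ {y | e y ≤ m}, ∀ r, r + h ≤ t →
        𝒳.semigroup h (H r) y ≤ H (r + h) y + δ / t * h :=
      (eventually_all_finite hfin).2 fun y _ => hloc y _ (by positivity)
    obtain ⟨n, hn⟩ := ((tendsto_div_nat_succ_nhdsGT ht).eventually hev).exists
    have := 𝒳.setIntegral_gridStay_le (H := H) (B := B) (ε := δ / t) (by positivity)
      {y | e y ≤ m} (t / ((n + 1 : ℕ) : ℝ≥0)) (n + 1) (by rwa [hgrid]) (by rwa [hgrid])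
      (by rwa [hgrid]) x
    rw [hgrid] at this
    have hsum : ((n + 1 : ℕ) : ℝ) * (δ / t * ((t / ((n + 1 : ℕ) : ℝ≥0) : ℝ≥0) : ℝ)) = δ := by
      have : (t : ℝ) ≠ 0 := by positivity
      push_cast
      field_simp
    rw [hsum] at this
    refine le_trans (setIntegral_mono_set hint.integrableOn
      (ae_of_all _ fun ω => hH0 _ zero_le _) ?_) this
    exact LE.le.eventuallyLE (Set.iInter_subset _ n)
  have hlim := tendsto_setIntegral_of_monotone hGmeas hGmono hint.integrableOn
  refine le_of_tendsto' (hlim.congr' ?_ |>.trans ?_) hG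
  · exact EventuallyEq.rfl
  · rw [semigroup, Measure.restrict_eq_self_of_ae_mem]
    filter_upwards [𝒳.stepPath x] with ω hω
    obtain ⟨m, hm⟩ := ((hω.finite_image_Icc t).image e).bddAbove
    refine Set.mem_iUnion.2 ⟨m, Set.mem_iInter.2 fun n j hj => ?_⟩
    refine hm ⟨_, ⟨_, ⟨zero_le, ?_⟩, rfl⟩, rfl⟩
    calc (j : ℝ≥0) * (t / ((n + 1 : ℕ) : ℝ≥0))
        ≤ ((n + 1 : ℕ) : ℝ≥0) * (t / ((n + 1 : ℕ) : ℝ≥0)) := by gcongr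
      _ = t := hgrid n

end RegularMarkovChain

theorem abs_sub_le_of_bounded {E : Type*} {φ : E → ℝ} {B : ℝ} (hφ : ∀ y, |φ y| ≤ B) (x y : E) :
    |φ y - φ x| ≤ 2 * B :=
  (abs_sub _ _).trans (by linarith [hφ x, hφ y])

namespace RegularMarkovChain

variable {E Ω : Type*} [MeasurableSpace E] [MeasurableSpace Ω] (𝒳 : RegularMarkovChain E Ω)

/-! ### Short-time expansion of the semigroup -/

/-- The transition probability `P_t(x, y)`. -/
noncomputable def trans (t : ℝ≥0) (x y : E) : ℝ :=
  (𝒳.law x).real {ω | 𝒳.X t ω = y}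

theorem trans_nonneg (t : ℝ≥0) (x y : E) : 0 ≤ 𝒳.trans t x y := measureReal_nonneg

theorem trans_eq_kernel [DiscreteMeasurableSpace E] (t : ℝ≥0) (x y : E) :
    𝒳.trans t x y = (𝒳.kernel t x).real {y} :=
  (map_measureReal_apply (𝒳.measurable_X t) (MeasurableSet.singleton y)).symm

theorem hasSum_semigroup [DiscreteMeasurableSpace E] [Countable E] {φ : E → ℝ} {B : ℝ}
    (hφ : ∀ y, |φ y| ≤ B) (t : ℝ≥0) (x : E) :
    HasSum (fun y => 𝒳.trans t x y * φ y) (𝒳.semigroup t φ x) := by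
  have hfin : IsFiniteMeasure (𝒳.kernel t x) :=
    Measure.isFiniteMeasure_map (𝒳.law x) (𝒳.X t)
  have hint : Integrable φ (𝒳.kernel t x) :=
    Integrable.of_bound (Measurable.of_discrete).aestronglyMeasurable B (ae_of_all _ hφ)
  rw [semigroup_eq_integral_kernel]
  simp_rw [trans_eq_kernel]
  rw [← Measure.sum_smul_dirac (𝒳.kernel t x)] at hint
  have := hasSum_integral_measure hint
  simpa only [integral_smul_measure, integral_dirac, Measure.sum_smul_dirac, measureReal_def,
    smul_eq_mul] using this

theorem summable_trans [DiscreteMeasurableSpace E] [Countable E] (t : ℝ≥0) (x : E) :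
    Summable (𝒳.trans t x) := by
  simpa using (𝒳.hasSum_semigroup (φ := fun _ => 1) (B := 1) (by simp) t x).summable

/-- The difference quotient `P_h(x, y) / h` off the diagonal, which approximates `Q(x, y)`. -/
noncomputable def quotRate (x : E) (h : ℝ≥0) : E → ℝ :=
  ({x}ᶜ : Set E).indicator fun y => 𝒳.trans h x y / h

/-- The transition rates out of `x`, set to zero on the diagonal. -/
noncomputable def offRate (x : E) : E → ℝ :=
  ({x}ᶜ : Set E).indicator (𝒳.rate x)

theorem offRate_nonneg (x y : E) : 0 ≤ 𝒳.offRate x y :=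
  Set.indicator_apply_nonneg fun h => 𝒳.rate_nonneg x y (Ne.symm h)

theorem quotRate_nonneg (x : E) (h : ℝ≥0) (y : E) : 0 ≤ 𝒳.quotRate x h y :=
  Set.indicator_apply_nonneg fun _ => div_nonneg (𝒳.trans_nonneg h x y) h.2

theorem summable_offRate (x : E) : Summable (𝒳.offRate x) :=
  (𝒳.rate_summable x).indicator _

theorem summable_quotRate [DiscreteMeasurableSpace E] [Countable E] (x : E) (h : ℝ≥0) :
    Summable (𝒳.quotRate x h) :=
  ((𝒳.summable_trans h x).div_const _).indicator _

theorem sub_mul_offRate (φ : E → ℝ) (x y : E) :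
    (φ y - φ x) * 𝒳.offRate x y = (φ y - φ x) * 𝒳.rate x y := by
  rcases eq_or_ne y x with rfl | h
  · simp
  · simp [offRate, h]

theorem tendsto_quotRate [DiscreteMeasurableSpace E] [Countable E] (x y : E) :
    Tendsto (fun h => 𝒳.quotRate x h y) (𝓝[>] 0) (𝓝 (𝒳.offRate x y)) := by
  rcases eq_or_ne y x with rfl | hne
  · simp [quotRate, offRate]
  have hφ : ∀ z, |({y} : Set E).indicator (fun _ => (1 : ℝ)) z| ≤ 1 := fun z => by
    by_cases hz : z = y <;> simp [hz]
  have := 𝒳.generator _ ⟨1, hφ⟩ x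
  rw [tsum_eq_single y (fun z hz => by simp [hz, hne.symm])] at this
  simp only [Set.mem_singleton_iff, hne.symm, not_false_eq_true, Set.indicator_of_notMem, sub_zero,
    Set.indicator_of_mem (Set.mem_singleton y), one_mul] at this
  simp only [quotRate, offRate, Set.indicator_of_mem (s := ({x}ᶜ : Set E)) (a := y) hne]
  refine this.congr fun h => ?_
  congr 1
  have h1 := (𝒳.hasSum_semigroup hφ h x).tsum_eq
  rw [tsum_eq_single y (fun z hz => by simp [hz])] at h1
  rw [← semigroup, ← h1]
  simp

theorem tendsto_tsum_quotRate [DiscreteMeasurableSpace E] [Countable E] (x : E) :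
    Tendsto (fun h => ∑' y, 𝒳.quotRate x h y) (𝓝[>] 0) (𝓝 (∑' y, 𝒳.offRate x y)) := by
  have hφ : ∀ z, |({x}ᶜ : Set E).indicator (fun _ => (1 : ℝ)) z| ≤ 1 := fun z => by
    by_cases hz : z = x <;> simp [hz]
  have := 𝒳.generator _ ⟨1, hφ⟩ x
  have h1 : ∀ y, (({x}ᶜ : Set E).indicator (fun _ => (1 : ℝ)) y
      - ({x}ᶜ : Set E).indicator (fun _ => (1 : ℝ)) x) * 𝒳.rate x y = 𝒳.offRate x y := fun y => by
    by_cases hy : y = x <;> simp [hy, offRate]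
  simp_rw [h1] at this
  refine this.congr fun h => ?_
  rw [← semigroup, ← (𝒳.hasSum_semigroup hφ h x).tsum_eq]
  simp only [Set.mem_compl_iff, Set.mem_singleton_iff, not_true_eq_false, not_false_eq_true,
    Set.indicator_of_notMem, sub_zero]
  rw [← tsum_div_const]
  refine tsum_congr fun y => ?_
  by_cases hy : y = x <;> simp [hy, quotRate]

/-- The `ℓ¹` distance between the difference quotients `P_h(x, ·) / h` and the rates `Q(x, ·)`. -/
noncomputable def rateError (x : E) (h : ℝ≥0) : ℝ :=
  ∑' y, |𝒳.quotRate x h y - 𝒳.offRate x y|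

theorem summable_rateError [DiscreteMeasurableSpace E] [Countable E] (x : E) (h : ℝ≥0) :
    Summable fun y => |𝒳.quotRate x h y - 𝒳.offRate x y| :=
  ((𝒳.summable_quotRate x h).sub (𝒳.summable_offRate x)).abs

/-- Scheffé's lemma: pointwise convergence and convergence of the total masses give convergence
in `ℓ¹`. -/
theorem tendsto_rateError [DiscreteMeasurableSpace E] [Countable E] (x : E) :
    Tendsto (𝒳.rateError x) (𝓝[>] 0) (𝓝 0) := by
  have hle (h : ℝ≥0) (y : E) :
      max (𝒳.offRate x y - 𝒳.quotRate x h y) 0 ≤ 𝒳.offRate x y :=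
    max_le (sub_le_self _ (𝒳.quotRate_nonneg x h y)) (𝒳.offRate_nonneg x y)
  have hsum (h : ℝ≥0) : Summable fun y => max (𝒳.offRate x y - 𝒳.quotRate x h y) 0 :=
    (𝒳.summable_offRate x).of_nonneg_of_le (fun _ => le_max_right _ _) (hle h)
  have hpos : Tendsto (fun h => ∑' y, max (𝒳.offRate x y - 𝒳.quotRate x h y) 0) (𝓝[>] 0)
      (𝓝 (∑' _ : E, (0 : ℝ))) := by
    refine tendsto_tsum_of_dominated_convergence (𝒳.summable_offRate x) (fun y => ?_)
      (Eventually.of_forall fun h y => ?_)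
    · have := ((tendsto_const_nhds (x := 𝒳.offRate x y)).sub (𝒳.tendsto_quotRate x y)).max
        (tendsto_const_nhds (x := (0 : ℝ)))
      simpa using this
    · rw [Real.norm_of_nonneg (le_max_right _ _)]
      exact hle h y
  have hlim := ((𝒳.tendsto_tsum_quotRate x).sub_const (∑' y, 𝒳.offRate x y)).add
    (hpos.const_mul 2)
  simp only [sub_self, tsum_zero, mul_zero, add_zero] at hlim
  refine hlim.congr fun h => ?_
  rw [rateError, ← (𝒳.summable_quotRate x h).tsum_sub (𝒳.summable_offRate x), ← tsum_mul_left,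
    ← ((𝒳.summable_quotRate x h).sub (𝒳.summable_offRate x)).tsum_add ((hsum h).mul_left 2)]
  refine tsum_congr fun y => ?_
  rcases le_total (𝒳.offRate x y) (𝒳.quotRate x h y) with hy | hy
  · rw [max_eq_right (by linarith), abs_of_nonneg (by linarith)]
    ring
  · rw [max_eq_left (by linarith), abs_of_nonpos (by linarith)]
    ring

/-- The generator on bounded functions. -/
noncomputable def gen (φ : E → ℝ) (x : E) : ℝ :=
  ∑' y, (φ y - φ x) * 𝒳.rate x y

theorem summable_gen {φ : E → ℝ} {B : ℝ} (hφ : ∀ y, |φ y| ≤ B) (x : E) :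
    Summable fun y => (φ y - φ x) * 𝒳.rate x y := by
  refine ((𝒳.summable_offRate x).mul_left (2 * B)).of_norm_bounded fun y => ?_
  rw [← 𝒳.sub_mul_offRate, norm_mul, Real.norm_of_nonneg (𝒳.offRate_nonneg x y)]
  exact mul_le_mul_of_nonneg_right (abs_sub_le_of_bounded hφ x y) (𝒳.offRate_nonneg x y)

/-- The short-time expansion `P_h φ = φ + h 𝓛 φ + o(h)` at a state, with a remainder that depends
on `φ` through its bound only. -/
theorem abs_semigroup_sub_le [DiscreteMeasurableSpace E] [Countable E] {φ : E → ℝ} {B : ℝ}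
    (hφ : ∀ y, |φ y| ≤ B) {h : ℝ≥0} (hh : 0 < h) (x : E) :
    |𝒳.semigroup h φ x - φ x - h * 𝒳.gen φ x| ≤ h * (2 * B * 𝒳.rateError x h) := by
  have hone : HasSum (𝒳.trans h x) 1 := by
    simpa [semigroup] using 𝒳.hasSum_semigroup (φ := fun _ => 1) (B := 1) (by simp) h x
  have h0 : (h : ℝ) ≠ 0 := by positivity
  have h1 : HasSum (fun y => h * ((φ y - φ x) * 𝒳.quotRate x h y))
      (𝒳.semigroup h φ x - φ x) := by
    convert! (𝒳.hasSum_semigroup hφ h x).sub (hone.mul_right (φ x)) using 1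
    · funext y
      rcases eq_or_ne y x with rfl | hy
      · simp
      · simp only [quotRate, Set.indicator_of_mem (s := ({x}ᶜ : Set E)) (a := y) hy]
        field_simp
    · ring
  have h2 := (𝒳.summable_gen hφ x).hasSum.mul_left (h : ℝ)
  have h3 := h1.sub h2
  rw [gen, ← h3.tsum_eq, ← Real.norm_eq_abs]
  refine tsum_of_norm_bounded
    ((𝒳.summable_rateError x h).hasSum.mul_left (2 * B) |>.mul_left (h : ℝ)) fun y => ?_
  rw [← 𝒳.sub_mul_offRate, ← mul_sub, ← mul_sub, norm_mul, norm_mul,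
    Real.norm_of_nonneg (NNReal.coe_nonneg h)]
  refine mul_le_mul_of_nonneg_left ?_ h.2
  exact mul_le_mul_of_nonneg_right (abs_sub_le_of_bounded hφ x y) (norm_nonneg _)

end RegularMarkovChain

/-! ### Long jumps have rate zero -/

/-- If a step path is at `x` and at `y` at consecutive times of arbitrarily fine grids of `[0, T]`,
then it has a jump from `x` to `y`. -/
theorem IsStepPath.exists_jump {E : Type*} {w : ℝ≥0 → E} (hw : IsStepPath w) {x y : E}
    (hxy : x ≠ y) {T : ℝ≥0} {h : ℕ → ℝ≥0} (hh : Tendsto h atTop (𝓝 0))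
    (hfreq : ∃ᶠ n in atTop, ∃ r ≤ T, w r = x ∧ w (r + h n) = y) :
    ∃ s, 0 < s ∧ IsLeftValue w s x ∧ w s = y := by
  obtain ⟨ns, hns, hP⟩ := extraction_of_frequently_atTop hfreq
  choose r hrT hrx hry using hP
  obtain ⟨s, -, ψ, hψ, hlim⟩ := (isCompact_Icc (a := (0 : ℝ≥0)) (b := T)).tendsto_subseq
    (x := r) fun n => ⟨zero_le, hrT n⟩
  have hlim' : Tendsto (fun n => r (ψ n) + h (ns (ψ n))) atTop (𝓝 s) := by
    simpa using hlim.add (hh.comp (hns.tendsto_atTop.comp hψ.tendsto_atTop))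
  obtain ⟨z, hz⟩ := hw.eventually_nhds s
  obtain ⟨n, hn, hn'⟩ := ((hlim.eventually hz).and (hlim'.eventually hz)).exists
  rcases lt_or_ge (r (ψ n)) s with h1 | h1
  · have hzx : z = x := (hn.1 h1).symm.trans (hrx _)
    rcases lt_or_ge (r (ψ n) + h (ns (ψ n))) s with h2 | h2
    · exact absurd (hzx.symm.trans ((hn'.1 h2).symm.trans (hry _))) hxy
    · refine ⟨s, zero_le.trans_lt h1, ?_, (hn'.2 h2).symm.trans (hry _)⟩
      rw [← hzx]
      exact eventually_nhdsWithin_iff.2 (hz.mono fun _ h => h.1)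
  · have h2 : s ≤ r (ψ n) + h (ns (ψ n)) := h1.trans le_self_add
    exact absurd ((hrx _).symm.trans ((hn.2 h1).trans ((hn'.2 h2).symm.trans (hry _)))) hxy

namespace RegularMarkovChain

variable {E Ω : Type*} [MeasurableSpace E] [MeasurableSpace Ω] (𝒳 : RegularMarkovChain E Ω)

theorem measureReal_inter_X_add [DiscreteMeasurableSpace E] (x : E) (s t : ℝ≥0) (y z : E)
    {A : Set Ω} (hA : MeasurableSet[𝒳.filt s] A) (hAz : ∀ ω ∈ A, 𝒳.X s ω = z) :
    (𝒳.law x).real (A ∩ {ω | 𝒳.X (s + t) ω = y}) = (𝒳.law x).real A * 𝒳.trans t z y := by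
  have h := 𝒳.markov x s t y A hA
  rw [setLIntegral_congr_fun (g := fun _ => 𝒳.law z {ω' | 𝒳.X t ω' = y}) (𝒳.filt.le s _ hA)
    (fun ω hω => by simp only [hAz ω hω]), setLIntegral_const] at h
  rw [trans, measureReal_def, measureReal_def, measureReal_def, h, ENNReal.toReal_mul, mul_comm]

theorem measureReal_gridStay_singleton [DiscreteMeasurableSpace E] (x : E) (h : ℝ≥0) (k : ℕ) :
    (𝒳.law x).real (𝒳.gridStay {x} h (k + 1)) = 𝒳.trans h x x ^ k := by
  induction k with
  | zero =>
    have : 𝒳.gridStay {x} h 1 =ᵐ[𝒳.law x] Set.univ := by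
      filter_upwards [𝒳.start x] with ω hω
      refine propext ⟨fun _ => trivial, fun _ j hj => ?_⟩
      obtain rfl : j = 0 := by omega
      simpa using hω
    rw [zero_add, measureReal_congr this]
    simp
  | succ k ih =>
    rw [gridStay_succ, pow_succ, ← ih]
    have e : ((k + 1 : ℕ) : ℝ≥0) * h = k * h + h := by push_cast; ring
    rw [e]
    exact 𝒳.measureReal_inter_X_add x _ h x x (𝒳.measurableSet_gridStay_succ _ _ _)
      fun ω hω => hω k (Nat.lt_succ_self k)

/-- The event that the chain stays at `x` at the grid times `0, h, …, k h` for some `k < n`, and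
is at `y` at the next grid time. -/
def gridJump (x y : E) (h : ℝ≥0) (n : ℕ) : Set Ω :=
  ⋃ k ∈ Finset.range n, 𝒳.gridStay {x} h (k + 1) ∩ {ω | 𝒳.X (k * h + h) ω = y}

theorem measurableSet_gridJump [DiscreteMeasurableSpace E] (x y : E) (h : ℝ≥0) (n : ℕ) :
    MeasurableSet (𝒳.gridJump x y h n) :=
  Finset.measurableSet_biUnion _ fun _ _ => (𝒳.measurableSet_gridStay _ _ _).inter
    (𝒳.measurable_X _ (MeasurableSet.singleton y))

theorem measureReal_gridJump [DiscreteMeasurableSpace E] {x y : E} (hxy : x ≠ y) (h : ℝ≥0)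
    (n : ℕ) : (𝒳.law x).real (𝒳.gridJump x y h n) =
      ∑ k ∈ Finset.range n, 𝒳.trans h x x ^ k * 𝒳.trans h x y := by
  rw [gridJump, measureReal_biUnion_finset]
  · refine Finset.sum_congr rfl fun k _ => ?_
    rw [← 𝒳.measureReal_gridStay_singleton x h k]
    exact 𝒳.measureReal_inter_X_add x _ h y x (𝒳.measurableSet_gridStay_succ _ _ _)
      fun ω hω => hω k (Nat.lt_succ_self k)
  · have key : ∀ i j : ℕ, i < j → Disjoint
        (𝒳.gridStay {x} h (i + 1) ∩ {ω | 𝒳.X (i * h + h) ω = y})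
        (𝒳.gridStay {x} h (j + 1) ∩ {ω | 𝒳.X (j * h + h) ω = y}) := fun i j hij => by
      refine Set.disjoint_left.2 fun ω hi hj => hxy ?_
      have h1 : 𝒳.X ((i + 1 : ℕ) * h) ω = x := hj.1 (i + 1) (by omega)
      have e : ((i + 1 : ℕ) : ℝ≥0) * h = i * h + h := by push_cast; ring
      rw [e] at h1
      exact h1.symm.trans hi.2
    intro i _ j _ hij
    rcases lt_or_gt_of_ne hij with h' | h'
    · exact key i j h'
    · exact (key j i h').symm
  · exact fun k _ => (𝒳.measurableSet_gridStay _ _ _).inter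
      (𝒳.measurable_X _ (MeasurableSet.singleton y))

theorem trans_self_eq [DiscreteMeasurableSpace E] [Countable E] (x : E) (h : ℝ≥0) (hh : 0 < h) :
    𝒳.trans h x x = 1 - h * ∑' y, 𝒳.quotRate x h y := by
  have hone : HasSum (𝒳.trans h x) 1 := by
    simpa [semigroup] using 𝒳.hasSum_semigroup (φ := fun _ => 1) (B := 1) (by simp) h x
  have h0 : (h : ℝ) ≠ 0 := by positivity
  have hsingle : HasSum (({x} : Set E).indicator (𝒳.trans h x)) (𝒳.trans h x x) := by
    have := hasSum_single (f := ({x} : Set E).indicator (𝒳.trans h x)) x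
      (fun y hy => by simp [hy])
    simpa using this
  have h2 := hsingle.add ((𝒳.summable_quotRate x h).hasSum.mul_left (h : ℝ))
  have h3 : (fun y => ({x} : Set E).indicator (𝒳.trans h x) y + h * 𝒳.quotRate x h y) =
      𝒳.trans h x := by
    funext y
    rcases eq_or_ne y x with rfl | hy
    · simp [quotRate]
    · simp only [quotRate, Set.indicator_of_mem (s := ({x}ᶜ : Set E)) (a := y) hy]
      simp only [Set.mem_singleton_iff, hy, not_false_eq_true, Set.indicator_of_notMem, zero_add]
      field_simp
  rw [h3] at h2
  linarith [h2.unique hone]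

/-- If the rate from `x` to `y` is positive, then the chain started at `x` jumps from `x` to `y`
with positive probability. -/
theorem not_ae_no_jump [DiscreteMeasurableSpace E] [Countable E] {x y : E} (hxy : x ≠ y)
    (hrate : 0 < 𝒳.rate x y) :
    ¬ ∀ᵐ ω ∂(𝒳.law x), ¬ ∃ s, 0 < s ∧ IsLeftValue (fun r => 𝒳.X r ω) s x ∧ 𝒳.X s ω = y := by
  intro hno
  set q := 𝒳.rate x y with hq
  -- `c` exceeds the total rate out of `x`, and on `[0, T]` the chain stays at `x` with
  -- probability at least `1 / 2`
  set c := (∑' z, 𝒳.offRate x z) + 1 with hc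
  have hc0 : 0 < c := add_pos_of_nonneg_of_pos (tsum_nonneg (𝒳.offRate_nonneg x)) one_pos
  obtain ⟨T, hT⟩ : ∃ T : ℝ≥0, (T : ℝ) = 1 / (2 * c) := ⟨⟨1 / (2 * c), by positivity⟩, rfl⟩
  have hT0 : (0 : ℝ) < T := by rw [hT]; positivity
  let h : ℕ → ℝ≥0 := fun n => T / ((n + 1 : ℕ) : ℝ≥0)
  have hlim : Tendsto h atTop (𝓝[>] 0) := tendsto_div_nat_succ_nhdsGT (by exact_mod_cast hT0)
  have hgrid (n : ℕ) : ((n + 1 : ℕ) : ℝ) * h n = T := by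
    simp only [h, NNReal.coe_div, NNReal.coe_natCast]
    field_simp
  have hgrid' (n : ℕ) : ((n + 1 : ℕ) : ℝ≥0) * h n = T := by exact_mod_cast hgrid n
  let J : ℕ → Set Ω := fun n => 𝒳.gridJump x y (h n) (n + 1)
  have hJ : ∀ᶠ n in atTop, T * (q / 4) ≤ (𝒳.law x).real (J n) := by
    have h1 : ∀ᶠ r in 𝓝[>] (0 : ℝ≥0), ∑' z, 𝒳.quotRate x r z < c :=
      (𝒳.tendsto_tsum_quotRate x).eventually_lt_const (by linarith)
    have h2 : ∀ᶠ r in 𝓝[>] (0 : ℝ≥0), q / 2 < 𝒳.quotRate x r y := by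
      refine (𝒳.tendsto_quotRate x y).eventually_const_lt ?_
      simp only [offRate, Set.indicator_of_mem (s := ({x}ᶜ : Set E)) (a := y) hxy.symm]
      linarith
    filter_upwards [hlim.eventually h1, hlim.eventually h2,
      hlim.eventually self_mem_nhdsWithin] with n hn1 hn2 hn3
    have hn3 : 0 < h n := hn3
    have hn0 : (0 : ℝ) < h n := hn3
    simp only [quotRate, Set.indicator_of_mem (s := ({x}ᶜ : Set E)) (a := y) hxy.symm] at hn2
    rw [lt_div_iff₀ hn0] at hn2
    have hp := 𝒳.trans_self_eq x (h n) hn3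
    have hp1 : 1 - h n * c ≤ 𝒳.trans (h n) x x := by
      rw [hp]
      gcongr
    have hp2 : 𝒳.trans (h n) x x ≤ 1 := measureReal_le_one
    have hhT : (h n : ℝ) * c ≤ 1 / 2 := by
      have : (h n : ℝ) ≤ T := by
        rw [← hgrid n]
        refine le_mul_of_one_le_left hn0.le ?_
        push_cast
        linarith [Nat.cast_nonneg (α := ℝ) n]
      calc (h n : ℝ) * c ≤ T * c := by gcongr
        _ = 1 / 2 := by rw [hT]; field_simp
    have hpow : 1 / 2 ≤ 𝒳.trans (h n) x x ^ (n + 1) := by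
      calc (1 / 2 : ℝ) = 1 + ((n + 1 : ℕ) : ℝ) * (-(h n * c)) := by
            rw [mul_neg, ← mul_assoc, hgrid, hT]
            field_simp
            norm_num
        _ ≤ (1 + -(h n * c)) ^ (n + 1) := one_add_mul_le_pow (by linarith) _
        _ ≤ _ := pow_le_pow_left₀ (by linarith) (by linarith) _
    rw [𝒳.measureReal_gridJump hxy]
    calc T * (q / 4) = ∑ k ∈ Finset.range (n + 1), 1 / 2 * (q / 2 * h n) := by
          rw [Finset.sum_const, Finset.card_range, nsmul_eq_mul, ← hgrid n]
          ring
      _ ≤ _ := by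
          refine Finset.sum_le_sum fun k hk => ?_
          have hk : k ≤ n + 1 := (Finset.mem_range.1 hk).le
          refine mul_le_mul (hpow.trans ?_) hn2.le (by positivity)
            (pow_nonneg measureReal_nonneg k)
          exact pow_le_pow_of_le_one measureReal_nonneg hp2 hk
  -- the event that a jump is seen on infinitely many grids
  have hanti : Antitone fun m => ⋃ n ≥ m, J n := fun m m' hm =>
    Set.iUnion₂_mono' fun n hn => ⟨n, le_trans hm hn, subset_rfl⟩
  have hmeas : ∀ m, MeasurableSet (⋃ n ≥ m, J n) := fun m =>
    MeasurableSet.iUnion fun n => MeasurableSet.iUnion fun _ => 𝒳.measurableSet_gridJump _ _ _ _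
  have htend := tendsto_measure_iInter_atTop (μ := 𝒳.law x)
    (fun m => (hmeas m).nullMeasurableSet) hanti ⟨0, measure_ne_top _ _⟩
  have hzero : 𝒳.law x (⋂ m, ⋃ n ≥ m, J n) = 0 := by
    refine measure_mono_null ?_ (ae_iff.1 (hno.and (𝒳.stepPath x)))
    intro ω hω
    rintro ⟨hω1, hω2⟩
    refine hω1 (hω2.exists_jump hxy (T := T) (tendsto_nhds_of_tendsto_nhdsWithin hlim) ?_)
    refine frequently_atTop.2 fun m => ?_
    obtain ⟨n, hn, hJn⟩ := Set.mem_iUnion₂.1 (Set.mem_iInter.1 hω m)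
    obtain ⟨k, hk, hk1, hk2⟩ := Set.mem_iUnion₂.1 hJn
    refine ⟨n, hn, k * h n, ?_, hk1 k (Nat.lt_succ_self k), hk2⟩
    rw [← hgrid' n]
    have := (Finset.mem_range.1 hk).le
    gcongr
  have hge : ENNReal.ofReal (T * (q / 4)) ≤ 𝒳.law x (⋂ m, ⋃ n ≥ m, J n) := by
    refine ge_of_tendsto htend ?_
    filter_upwards [hJ] with m hm
    refine (ENNReal.ofReal_le_ofReal hm).trans ?_
    rw [ofReal_measureReal]
    exact measure_mono (Set.subset_iUnion₂_of_subset m le_rfl subset_rfl)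
  rw [hzero, nonpos_iff_eq_zero, ENNReal.ofReal_eq_zero] at hge
  exact absurd hge (not_le.2 (by positivity))

/-- When the jumps are bounded by `b`, there is no rate from a state to a state farther than `b`. -/
theorem rate_eq_zero_of_lt_dist {E : Type*} [MetricSpace E] [MeasurableSpace E]
    [DiscreteMeasurableSpace E] [Countable E] (𝒳 : RegularMarkovChain E Ω) {b : ℝ} (hb : 0 ≤ b)
    (hjumps : 𝒳.JumpsBoundedBy b) {x y : E} (h : b < dist x y) : 𝒳.rate x y = 0 := by
  have hxy : x ≠ y := dist_pos.1 (hb.trans_lt h)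
  by_contra hne
  refine 𝒳.not_ae_no_jump hxy ((𝒳.rate_nonneg x y hxy).lt_of_ne' hne) ?_
  filter_upwards [hjumps x] with ω hω
  rintro ⟨s, hs, hleft, rfl⟩
  exact absurd (hω s hs x hleft) (not_le.2 h)

end RegularMarkovChain

/-! ### Lipschitz functions and the Wasserstein curvature -/

theorem lipSeminorm_le {E : Type*} [MetricSpace E] {f : E → ℝ} {L : ℝ}
    (hf : ∀ x y, |f x - f y| ≤ L * dist x y) : lipSeminorm f ≤ ENNReal.ofReal L := by
  refine iSup_le fun x => iSup_le fun y => iSup_le fun hxy => ENNReal.ofReal_le_ofReal ?_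
  rw [div_le_iff₀ (dist_pos.2 hxy)]
  exact hf x y

theorem abs_sub_le_of_lipSeminorm_le {E : Type*} [MetricSpace E] {f : E → ℝ} {L : ℝ} (hL : 0 ≤ L)
    (hf : lipSeminorm f ≤ ENNReal.ofReal L) (x y : E) : |f x - f y| ≤ L * dist x y := by
  rcases eq_or_ne x y with rfl | hxy
  · simp
  have h : ENNReal.ofReal (|f x - f y| / dist x y) ≤ ENNReal.ofReal L :=
    iSup_le_iff.1 (iSup_le_iff.1 (iSup_le_iff.1 hf x) y) hxy
  rwa [ENNReal.ofReal_le_ofReal_iff hL, div_le_iff₀ (dist_pos.2 hxy)] at h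

theorem IsLip.abs_sub_le {E : Type*} [MetricSpace E] {f : E → ℝ} (hf : IsLip f) (x y : E) :
    |f x - f y| ≤ (lipSeminorm f).toReal * dist x y :=
  abs_sub_le_of_lipSeminorm_le ENNReal.toReal_nonneg (ENNReal.ofReal_toReal hf.ne).ge x y

theorem lipSeminorm_eq_zero_iff {E : Type*} [MetricSpace E] {f : E → ℝ} :
    lipSeminorm f = 0 ↔ ∀ x y, f x = f y := by
  constructor
  · intro h x y
    have := abs_sub_le_of_lipSeminorm_le le_rfl (h.trans_le zero_le) x y
    rw [zero_mul] at this
    exact sub_eq_zero.1 (abs_nonpos_iff.1 this)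
  · intro h
    have := lipSeminorm_le (f := f) (L := 0) fun x y => by simp [h x y]
    simpa using this

/-- Truncation of `f` to the interval `[-n, n]`. -/
def truncAt {E : Type*} (f : E → ℝ) (n : ℕ) (y : E) : ℝ :=
  max (-(n : ℝ)) (min (f y) n)

theorem abs_truncAt_le {E : Type*} (f : E → ℝ) (n : ℕ) (y : E) : |truncAt f n y| ≤ n :=
  abs_le.2 ⟨le_max_left _ _,
    max_le (neg_le_self (Nat.cast_nonneg n)) (min_le_right _ _)⟩

theorem truncAt_of_abs_le {E : Type*} {f : E → ℝ} {n : ℕ} {y : E} (h : |f y| ≤ n) :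
    truncAt f n y = f y := by
  rw [truncAt, min_eq_left (abs_le.1 h).2, max_eq_right (abs_le.1 h).1]

theorem abs_truncAt_le_abs {E : Type*} (f : E → ℝ) (n : ℕ) (y : E) : |truncAt f n y| ≤ |f y| := by
  rcases le_total |f y| n with h | h
  · rw [truncAt_of_abs_le h]
  · exact (abs_truncAt_le f n y).trans h

theorem abs_truncAt_sub_le {E : Type*} (f : E → ℝ) (n : ℕ) (x y : E) :
    |truncAt f n x - truncAt f n y| ≤ |f x - f y| := by
  simp only [truncAt]
  rw [max_comm _ (min (f x) _), max_comm _ (min (f y) _)]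
  refine (abs_max_sub_max_le_abs _ _ _).trans ((abs_min_sub_min_le_max _ _ _ _).trans ?_)
  simp

theorem tendsto_truncAt {E : Type*} (f : E → ℝ) (y : E) :
    Tendsto (fun n => truncAt f n y) atTop (𝓝 (f y)) := by
  refine tendsto_const_nhds.congr' ?_
  filter_upwards [eventually_ge_atTop ⌈|f y|⌉₊] with n hn
  exact (truncAt_of_abs_le (Nat.ceil_le.1 hn)).symm

theorem lintegral_le_of_tendsto_of_forall_le {Ω : Type*} [MeasurableSpace Ω] {μ : Measure Ω}
    {F : ℕ → Ω → ℝ≥0∞} {g : Ω → ℝ≥0∞} {C : ℝ≥0∞} (hF : ∀ n, Measurable (F n))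
    (hlim : ∀ ω, Tendsto (fun n => F n ω) atTop (𝓝 (g ω))) (hC : ∀ n, ∫⁻ ω, F n ω ∂μ ≤ C) :
    ∫⁻ ω, g ω ∂μ ≤ C := by
  calc ∫⁻ ω, g ω ∂μ = ∫⁻ ω, liminf (fun n => F n ω) atTop ∂μ :=
        lintegral_congr fun ω => (hlim ω).liminf_eq.symm
    _ ≤ liminf (fun n => ∫⁻ ω, F n ω ∂μ) atTop := lintegral_liminf_le hF
    _ ≤ liminf (fun _ : ℕ => C) atTop := liminf_le_liminf (Eventually.of_forall hC)
    _ = C := liminf_const _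

namespace RegularMarkovChain

variable {E Ω : Type*} [MetricSpace E] [MeasurableSpace E] [MeasurableSpace Ω]
  (𝒳 : RegularMarkovChain E Ω)

/-- A lower bound on the curvature contracts Lipschitz constants along the semigroup. -/
theorem WassersteinCurvatureBoundedBelow.abs_semigroup_sub_le {𝒳 : RegularMarkovChain E Ω} {K : ℝ}
    (hcurv : 𝒳.WassersteinCurvatureBoundedBelow K) {f : E → ℝ} {L : ℝ} (hL : 0 ≤ L)
    (hf : ∀ x y, |f x - f y| ≤ L * dist x y) (t : ℝ≥0) (x y : E) :
    |𝒳.semigroup t f x - 𝒳.semigroup t f y| ≤ L * Real.exp (-K * t) * dist x y := by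
  rcases eq_zero_or_pos t with rfl | ht
  · simpa [semigroup_zero] using hf x y
  by_cases hconst : ∃ c, ∀ x, f x = c
  · obtain ⟨c, hc⟩ := hconst
    simp only [semigroup, hc, integral_const, probReal_univ, sub_self, abs_zero]
    positivity
  have hlip : lipSeminorm f ≤ ENNReal.ofReal L := lipSeminorm_le hf
  have hIsLip : IsLip f := hlip.trans_lt ENNReal.ofReal_lt_top
  have hne : lipSeminorm f ≠ 0 := fun h =>
    hconst ⟨f x, fun z => lipSeminorm_eq_zero_iff.1 h z x⟩
  have h1 : (K : EReal) ≤ 𝒳.wassersteinCurvature t :=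
    hcurv.2.trans (iInf₂_le t ht)
  rw [wassersteinCurvature] at h1
  have h2 := EReal.le_neg_of_le_neg h1
  have ht0 : (0 : EReal) < ((t : ℝ) : EReal) := by exact_mod_cast ht
  rw [one_div, EReal.coe_inv, mul_comm, ← div_eq_mul_inv,
    EReal.div_le_iff_le_mul ht0 (EReal.coe_ne_top _)] at h2
  have h3 := (le_iSup₂_of_le (f := fun (f : E → ℝ) (_ : IsLip f ∧ ¬ ∃ c, ∀ x, f x = c) =>
      ENNReal.log (lipSeminorm (𝒳.semigroup t f) / lipSeminorm f)) f ⟨hIsLip, hconst⟩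
      le_rfl).trans h2
  have h4 : ((t : ℝ) : EReal) * -(K : EReal) =
      ENNReal.log (ENNReal.ofReal (Real.exp (-K * t))) := by
    rw [ENNReal.log_ofReal_of_pos (Real.exp_pos _), Real.log_exp, ← EReal.coe_neg, ← EReal.coe_mul,
      mul_comm]
  rw [h4, ENNReal.log_le_log_iff, ENNReal.div_le_iff hne hIsLip.ne] at h3
  refine abs_sub_le_of_lipSeminorm_le (by positivity) (h3.trans ?_) x y
  rw [mul_comm L, ENNReal.ofReal_mul (Real.exp_pos _).le]
  gcongr

/-- Finiteness of the first moment passes from one starting point to all the others, by the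
Lipschitz bound on `P_t` applied to truncations of the distance. -/
theorem WassersteinCurvatureBoundedBelow.integrable [DiscreteMeasurableSpace E]
    {𝒳 : RegularMarkovChain E Ω} {K : ℝ} (hcurv : 𝒳.WassersteinCurvatureBoundedBelow K)
    {f : E → ℝ} {L : ℝ} (hf : ∀ x y, |f x - f y| ≤ L * dist x y) {t : ℝ≥0} (ht : 0 < t) (x : E) :
    Integrable (fun ω => f (𝒳.X t ω)) (𝒳.law x) := by
  obtain ⟨x₀, z, hz⟩ := hcurv.1 t ht
  have hmeas {g : E → ℝ} : Measurable fun ω => g (𝒳.X t ω) :=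
    Measurable.of_discrete.comp (𝒳.measurable_X t)
  set ρ : E → ℝ := fun y => dist y z with hρ
  have hρlip : ∀ y y', |ρ y - ρ y'| ≤ 1 * dist y y' := fun y y' => by
    simpa using abs_dist_sub_le y y' z
  set C := ∫ ω, ρ (𝒳.X t ω) ∂(𝒳.law x₀) + 1 * Real.exp (-K * t) * dist x x₀ with hC
  have hbound (n : ℕ) : 𝒳.semigroup t (truncAt ρ n) x ≤ C := by
    have h1 := hcurv.abs_semigroup_sub_le zero_le_one
      (fun y y' => (abs_truncAt_sub_le ρ n y y').trans (hρlip y y')) t x x₀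
    have h2 : 𝒳.semigroup t (truncAt ρ n) x₀ ≤ ∫ ω, ρ (𝒳.X t ω) ∂(𝒳.law x₀) := by
      refine integral_mono (𝒳.integrable_of_bounded (abs_truncAt_le ρ n) t x₀) hz fun ω => ?_
      refine (le_abs_self _).trans ((abs_truncAt_le_abs ρ n _).trans_eq ?_)
      exact abs_of_nonneg dist_nonneg
    linarith [(abs_le.1 h1).2]
  have hdist : Integrable (fun ω => ρ (𝒳.X t ω)) (𝒳.law x) := by
    refine (lintegral_ofReal_ne_top_iff_integrable (hmeas (g := ρ)).aestronglyMeasurable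
      (ae_of_all _ fun ω => dist_nonneg)).1
      (ne_top_of_le_ne_top (ENNReal.ofReal_ne_top (r := C)) ?_)
    refine lintegral_le_of_tendsto_of_forall_le
      (F := fun n ω => ENNReal.ofReal (truncAt ρ n (𝒳.X t ω)))
      (fun n => (hmeas (g := truncAt ρ n)).ennreal_ofReal)
      (fun ω => ENNReal.tendsto_ofReal (tendsto_truncAt ρ _)) fun n => ?_
    have h0 : ∀ y, 0 ≤ truncAt ρ n y := fun y =>
      le_max_of_le_right (le_min dist_nonneg (Nat.cast_nonneg n))
    rw [← ofReal_integral_eq_lintegral_ofReal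
      (𝒳.integrable_of_bounded (abs_truncAt_le ρ n) t x) (ae_of_all _ fun ω => h0 _)]
    exact ENNReal.ofReal_le_ofReal (hbound n)
  refine ((hdist.const_mul L).add (integrable_const |f z|)).mono' hmeas.aestronglyMeasurable
    (ae_of_all _ fun ω => ?_)
  have h1 := hf (𝒳.X t ω) z
  have h2 := abs_sub_abs_le_abs_sub (f (𝒳.X t ω)) (f z)
  simp only [Real.norm_eq_abs, Pi.add_apply, hρ]
  linarith

end RegularMarkovChain

/-! ### Elementary inequalities -/

/-- The function `u ↦ (exp u - 1 - u) / u ^ 2` is largest on `[-β, β]` at `β`. -/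
theorem exp_sub_one_sub_le {u β : ℝ} (hβ : 0 < β) (hu : |u| ≤ β) :
    Real.exp u - 1 - u ≤ u ^ 2 * ((Real.exp β - 1 - β) / β ^ 2) := by
  have hs (v : ℝ) : HasSum (fun n : ℕ => v ^ (n + 2) / (n + 2).factorial)
      (Real.exp v - 1 - v) := by
    have h := NormedSpace.expSeries_div_hasSum_exp (𝔸 := ℝ) v
    rw [← Real.exp_eq_exp_ℝ] at h
    have h2 := (hasSum_nat_add_iff' 2).2 h
    simpa [Finset.sum_range_succ, sub_sub] using h2
  have h1 := (hs β).mul_left (u ^ 2 / β ^ 2)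
  have h2 : u ^ 2 * ((Real.exp β - 1 - β) / β ^ 2) = u ^ 2 / β ^ 2 * (Real.exp β - 1 - β) := by
    ring
  rw [h2]
  refine hasSum_le (fun n => ?_) (hs u) h1
  have h3 : u ^ n ≤ β ^ n := (le_abs_self _).trans (by
    rw [abs_pow]
    exact pow_le_pow_left₀ (abs_nonneg u) hu n)
  have h4 : u ^ 2 / β ^ 2 * (β ^ (n + 2) / (n + 2).factorial) =
      u ^ 2 * β ^ n / (n + 2).factorial := by
    rw [pow_add]
    field_simp
  rw [h4, pow_add, mul_comm (u ^ n)]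
  gcongr

theorem curvM_zero (K : ℝ) : curvM 0 K = 0 := by
  simp [curvM]

theorem curvM_add (r h K : ℝ) :
    curvM (r + h) K = curvM r K + Real.exp (-2 * K * r) * curvM h K := by
  by_cases hK : K = 0
  · simp [curvM, hK]
  · simp only [curvM, hK, if_false]
    rw [mul_add, Real.exp_add]
    ring

theorem curvM_pos {t : ℝ} (ht : 0 < t) (K : ℝ) : 0 < curvM t K := by
  by_cases hK : K = 0
  · simpa [curvM, hK] using ht
  simp only [curvM, hK, if_false]
  rcases lt_or_gt_of_ne hK with h | h
  · refine div_pos_of_neg_of_neg ?_ (by linarith)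
    rw [sub_neg, Real.one_lt_exp_iff]
    nlinarith
  · refine div_pos ?_ (by linarith)
    rw [sub_pos, Real.exp_lt_one_iff]
    nlinarith

theorem curvM_nonneg {t : ℝ} (ht : 0 ≤ t) (K : ℝ) : 0 ≤ curvM t K := by
  rcases ht.eq_or_lt with rfl | h
  · exact (curvM_zero K).ge
  · exact (curvM_pos h K).le

theorem curvM_le_curvM {r t : ℝ} (hrt : r ≤ t) (K : ℝ) : curvM r K ≤ curvM t K := by
  have := curvM_add r (t - r) K
  rw [add_sub_cancel] at this
  rw [this]
  exact le_add_of_nonneg_right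
    (mul_nonneg (Real.exp_pos _).le (curvM_nonneg (sub_nonneg.2 hrt) K))

theorem hasDerivAt_curvM_zero (K : ℝ) : HasDerivAt (fun t => curvM t K) 1 0 := by
  by_cases hK : K = 0
  · simp only [curvM, hK, if_true]
    exact hasDerivAt_id' 0
  · simp only [curvM, hK, if_false]
    have h := ((((hasDerivAt_id (0 : ℝ)).const_mul (-2 * K)).exp).const_sub 1).div_const (2 * K)
    convert! h using 1
    simp only [id, mul_zero, Real.exp_zero]
    field_simp

theorem tendsto_sub_curvM_div (K : ℝ) :
    Tendsto (fun h : ℝ≥0 => ((h : ℝ) - curvM h K) / h) (𝓝[>] 0) (𝓝 0) := by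
  have h1 := (hasDerivAt_iff_tendsto_slope.1 (hasDerivAt_curvM_zero K))
  have h2 : Tendsto (fun h : ℝ≥0 => (h : ℝ)) (𝓝[>] 0) (𝓝[≠] 0) := by
    refine tendsto_nhdsWithin_iff.2 ⟨?_, ?_⟩
    · exact (NNReal.continuous_coe.tendsto' 0 0 rfl).mono_left nhdsWithin_le_nhds
    · filter_upwards [self_mem_nhdsWithin] with h hh
      have : (0 : ℝ≥0) < h := hh
      exact NNReal.coe_ne_zero.2 this.ne'
  have h3 := (h1.comp h2).const_sub 1
  rw [sub_self] at h3
  refine h3.congr' ?_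
  filter_upwards [self_mem_nhdsWithin] with h hh
  have : (0 : ℝ≥0) < h := hh
  have h0 : (h : ℝ) ≠ 0 := by positivity
  simp only [Function.comp, slope_def_field, curvM_zero, sub_zero]
  field_simp

theorem exp_le_curvC {r t : ℝ} (hr : 0 ≤ r) (hrt : r ≤ t) (K : ℝ) :
    Real.exp (-K * r) ≤ curvC t K := by
  have hbdd : BddAbove (Set.range fun s : Set.Icc (0 : ℝ) t => Real.exp (-K * (t - s))) := by
    refine ⟨Real.exp (|K| * t), ?_⟩
    rintro _ ⟨s, rfl⟩
    refine Real.exp_le_exp.2 ?_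
    refine mul_le_mul (neg_le_abs K) (by linarith [s.2.1]) (by linarith [s.2.2]) (abs_nonneg K)
  have := le_ciSup hbdd ⟨t - r, by linarith, by linarith⟩
  simpa [curvC] using this

theorem curvC_pos {t : ℝ} (ht : 0 ≤ t) (K : ℝ) : 0 < curvC t K :=
  (Real.exp_pos _).trans_le (exp_le_curvC le_rfl ht K)

namespace RegularMarkovChain

variable {E Ω : Type*} [MetricSpace E] [MeasurableSpace E] [DiscreteMeasurableSpace E] [Countable E]
  [MeasurableSpace Ω] (𝒳 : RegularMarkovChain E Ω)

/-! ### Exponential moments -/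

/-- The generator applied to an exponential: the second-order remainder
`exp (a g) * ∑ y, (exp Δ - 1 - Δ) * Q(x, y)`, with `Δ = a * (g y - g x)`, is controlled by the angle
bracket because only states within distance `b` contribute. -/
theorem gen_exp_le {b W : ℝ} (hb : 0 < b) (hjumps : 𝒳.JumpsBoundedBy b)
    (hbracket : 𝒳.AngleBracketBoundedBy W) {g : E → ℝ} {B L a β : ℝ} (hg : ∀ y, |g y| ≤ B)
    (hL : 0 ≤ L) (hlip : ∀ x y, |g x - g y| ≤ L * dist x y) (ha : 0 ≤ a) (hβ : 0 < β)
    (hβL : a * L * b ≤ β) (x : E) :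
    𝒳.gen (fun y => Real.exp (a * g y)) x ≤
      Real.exp (a * g x) *
        (a * 𝒳.gen g x + a ^ 2 * L ^ 2 * ((Real.exp β - 1 - β) / β ^ 2) * W) := by
  set ψ := (Real.exp β - 1 - β) / β ^ 2 with hψ
  have hψ0 : 0 ≤ ψ := div_nonneg (by linarith [Real.add_one_le_exp β]) (by positivity)
  obtain ⟨hsum, hle⟩ := hbracket x
  have hexp : ∀ y, |Real.exp (a * g y)| ≤ Real.exp (a * B) := fun y => by
    rw [abs_of_pos (Real.exp_pos _)]
    gcongr
    exact (le_abs_self _).trans (hg y)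
  have h1 := (𝒳.summable_gen hexp x).hasSum
  have h2 := (((𝒳.summable_gen hg x).hasSum.mul_left a).add
    (hsum.hasSum.mul_left (a ^ 2 * L ^ 2 * ψ))).mul_left (Real.exp (a * g x))
  have key : 𝒳.gen (fun y => Real.exp (a * g y)) x ≤ Real.exp (a * g x) *
      (a * 𝒳.gen g x + a ^ 2 * L ^ 2 * ψ * ∑' y, dist x y ^ 2 * 𝒳.rate x y) := by
    refine hasSum_le (fun y => ?_) h1 h2
    rcases eq_or_ne x y with rfl | hxy
    · simp
    rcases lt_or_ge b (dist x y) with hd | hd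
    · simp [𝒳.rate_eq_zero_of_lt_dist hb.le hjumps hd]
    have hr := 𝒳.rate_nonneg x y hxy
    have hΔ : |a * (g y - g x)| ≤ a * L * dist x y := by
      rw [abs_mul, abs_of_nonneg ha, mul_assoc, abs_sub_comm]
      gcongr
      exact hlip x y
    have hΔβ : |a * (g y - g x)| ≤ β := (hΔ.trans (by gcongr)).trans hβL
    have hE := exp_sub_one_sub_le hβ hΔβ
    have hsq : (a * (g y - g x)) ^ 2 ≤ (a * L * dist x y) ^ 2 := sq_le_sq' (abs_le.1 hΔ).1
      (abs_le.1 hΔ).2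
    have hfac : Real.exp (a * g y) = Real.exp (a * g x) * Real.exp (a * (g y - g x)) := by
      rw [← Real.exp_add]
      ring_nf
    rw [hfac]
    have hstep : Real.exp (a * (g y - g x)) - 1 ≤
        a * (g y - g x) + a ^ 2 * L ^ 2 * ψ * dist x y ^ 2 := by
      have := mul_le_mul_of_nonneg_right hsq hψ0
      linarith
    calc (Real.exp (a * g x) * Real.exp (a * (g y - g x)) - Real.exp (a * g x)) * 𝒳.rate x y
        = Real.exp (a * g x) * ((Real.exp (a * (g y - g x)) - 1) * 𝒳.rate x y) := by ring
      _ ≤ Real.exp (a * g x) *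
          ((a * (g y - g x) + a ^ 2 * L ^ 2 * ψ * dist x y ^ 2) * 𝒳.rate x y) := by gcongr
      _ = _ := by ring
  refine key.trans ?_
  gcongr

/-- The Bennett-type bound on exponential moments, for bounded Lipschitz functions.

The function `H r = exp (a * P_r f + c * M_{r,K})` satisfies `∂_r H ≥ 𝓛 H`, because `P_r f` solves
the backward equation, `∂_r M_{r,K} = exp (-2 * K * r)`, and `P_r f` is Lipschitz with constant
`L * exp (-K * r)`. -/
theorem semigroup_exp_le {b W K : ℝ} (hb : 0 < b) (hW : 0 ≤ W) (hjumps : 𝒳.JumpsBoundedBy b)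
    (hbracket : 𝒳.AngleBracketBoundedBy W) (hcurv : 𝒳.WassersteinCurvatureBoundedBelow K)
    {f : E → ℝ} {B L a β : ℝ} (hf : ∀ y, |f y| ≤ B)
    (hL : 0 ≤ L) (hlip : ∀ x y, |f x - f y| ≤ L * dist x y) (ha : 0 ≤ a) (hβ : 0 < β) {t : ℝ≥0}
    (ht : 0 < t) (hβL : a * (L * curvC t K) * b ≤ β) (x : E) :
    𝒳.semigroup t (fun y => Real.exp (a * f y)) x ≤ Real.exp (a * 𝒳.semigroup t f x +
      a ^ 2 * L ^ 2 * ((Real.exp β - 1 - β) / β ^ 2) * W * curvM t K) := by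
  set ψ := (Real.exp β - 1 - β) / β ^ 2 with hψ
  have hψ0 : 0 ≤ ψ := div_nonneg (by linarith [Real.add_one_le_exp β]) (by positivity)
  set c := a ^ 2 * L ^ 2 * ψ * W with hc
  have hc0 : 0 ≤ c := by positivity
  set H : ℝ≥0 → E → ℝ := fun r y => Real.exp (a * 𝒳.semigroup r f y + c * curvM r K) with hH
  set D := Real.exp (a * B + c * curvM t K) with hD
  have hH0 : ∀ r y, 0 < H r y := fun r y => Real.exp_pos _
  have hHD : ∀ r ≤ t, ∀ y, H r y ≤ D := fun r hr y => by
    refine Real.exp_le_exp.2 (add_le_add ?_ ?_)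
    · exact mul_le_mul_of_nonneg_left ((le_abs_self _).trans (𝒳.abs_semigroup_le hf r y)) ha
    · exact mul_le_mul_of_nonneg_left (curvM_le_curvM (by exact_mod_cast hr) K) hc0
  have hH0' : (fun y => Real.exp (a * f y)) = H 0 := by
    funext y
    simp [hH, semigroup_zero, curvM_zero]
  rw [hH0']
  refine 𝒳.semigroup_le_of_locally_le ht (fun r _ y => (hH0 r y).le) hHD (fun y ε hε => ?_) x
  -- the remainder, divided by `h`
  set R : ℝ≥0 → ℝ := fun h => D * (c * Real.exp (2 * |K| * t) * |((h : ℝ) - curvM h K) / h| +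
    a * (2 * B * 𝒳.rateError y h)) + 2 * D * 𝒳.rateError y h with hR
  have hRlim : Tendsto R (𝓝[>] 0) (𝓝 0) := by
    have h1 := (tendsto_sub_curvM_div K).abs
    have h2 := 𝒳.tendsto_rateError y
    have h3 := (((h1.const_mul (c * Real.exp (2 * |K| * t))).add
      ((h2.const_mul (2 * B)).const_mul a)).const_mul D).add (h2.const_mul (2 * D))
    simpa using h3
  filter_upwards [hRlim.eventually_lt_const hε, self_mem_nhdsWithin] with h hRε hh r hrt
  have hh : 0 < h := hh
  have hh0 : (0 : ℝ) < h := hh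
  have hr : r ≤ t := le_self_add.trans hrt
  have hrR : (r : ℝ) ≤ t := hr
  have hgB : ∀ z, |𝒳.semigroup r f z| ≤ B := 𝒳.abs_semigroup_le hf r
  -- one step of the semigroup applied to `H r`
  have hstep1 : 𝒳.semigroup h (H r) y ≤
      H r y + h * 𝒳.gen (H r) y + h * (2 * D * 𝒳.rateError y h) := by
    have := 𝒳.abs_semigroup_sub_le (φ := H r) (B := D) (fun z => by
      rw [abs_of_pos (hH0 r z)]
      exact hHD r hr z) hh y
    linarith [(abs_le.1 this).2]
  have hgen : 𝒳.gen (H r) y ≤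
      H r y * (a * 𝒳.gen (𝒳.semigroup r f) y + c * Real.exp (-2 * K * r)) := by
    have h1 := 𝒳.gen_exp_le hb hjumps hbracket hgB
      (mul_nonneg hL (Real.exp_pos (-K * r)).le)
      (fun z z' => hcurv.abs_semigroup_sub_le hL hlip r z z') ha hβ (by
        refine le_trans ?_ hβL
        gcongr
        exact exp_le_curvC r.2 hrR K) y
    have h2 : 𝒳.gen (H r) y = Real.exp (c * curvM r K) *
        𝒳.gen (fun z => Real.exp (a * 𝒳.semigroup r f z)) y := by
      simp only [gen, hH]
      rw [← tsum_mul_left]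
      refine tsum_congr fun z => ?_
      rw [Real.exp_add, Real.exp_add]
      ring
    have h3 : (L * Real.exp (-K * r)) ^ 2 = L ^ 2 * Real.exp (-2 * K * r) := by
      rw [mul_pow, ← Real.exp_nat_mul]
      congr 2
      push_cast
      ring
    rw [h2]
    refine (mul_le_mul_of_nonneg_left h1 (Real.exp_pos _).le).trans_eq ?_
    rw [h3]
    simp only [hH, hc, Real.exp_add]
    ring
  -- the increment of `H` in time
  have hinc : H r y * (1 + (a * (h * 𝒳.gen (𝒳.semigroup r f) y - h * (2 * B * 𝒳.rateError y h))
      + c * (Real.exp (-2 * K * r) * curvM h K))) ≤ H (r + h) y := by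
    have h1 := 𝒳.abs_semigroup_sub_le hgB hh y
    rw [← 𝒳.semigroup_add hf h r y, add_comm h r] at h1
    have h2 : H (r + h) y = H r y * Real.exp (a * (𝒳.semigroup (r + h) f y - 𝒳.semigroup r f y) +
        c * (Real.exp (-2 * K * r) * curvM h K)) := by
      simp only [hH]
      rw [NNReal.coe_add, curvM_add, ← Real.exp_add]
      ring_nf
    rw [h2]
    refine mul_le_mul_of_nonneg_left ?_ (hH0 r y).le
    refine le_trans ?_ (Real.add_one_le_exp _)
    have h3 : h * 𝒳.gen (𝒳.semigroup r f) y - h * (2 * B * 𝒳.rateError y h) ≤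
        𝒳.semigroup (r + h) f y - 𝒳.semigroup r f y := by linarith [(abs_le.1 h1).1]
    have := mul_le_mul_of_nonneg_left h3 ha
    linarith
  have hB : 0 ≤ B := (abs_nonneg _).trans (hf y)
  have herr : 0 ≤ 𝒳.rateError y h := tsum_nonneg fun _ => abs_nonneg _
  have hK : Real.exp (-2 * K * r) ≤ Real.exp (2 * |K| * t) := by
    refine Real.exp_le_exp.2 ?_
    calc -2 * K * r = 2 * (-K) * r := by ring
      _ ≤ 2 * |K| * t := by
        gcongr
        exact neg_le_abs K
  have hM : (h : ℝ) - curvM h K ≤ h * |((h : ℝ) - curvM h K) / h| := by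
    calc (h : ℝ) - curvM h K = h * (((h : ℝ) - curvM h K) / h) := by field_simp
      _ ≤ _ := mul_le_mul_of_nonneg_left (le_abs_self _) hh0.le
  have hrem : H r y * (c * Real.exp (-2 * K * r) * (h - curvM h K) +
      a * (h * (2 * B * 𝒳.rateError y h))) ≤
      D * (c * Real.exp (2 * |K| * t) * (h * |((h : ℝ) - curvM h K) / h|) +
      a * (h * (2 * B * 𝒳.rateError y h))) := by
    have h1 : c * Real.exp (-2 * K * r) * (h - curvM h K) ≤
        c * Real.exp (2 * |K| * t) * (h * |((h : ℝ) - curvM h K) / h|) :=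
      calc c * Real.exp (-2 * K * r) * (h - curvM h K)
          ≤ c * Real.exp (-2 * K * r) * (h * |((h : ℝ) - curvM h K) / h|) := by gcongr
        _ ≤ _ := by gcongr
    refine (mul_le_mul_of_nonneg_left (add_le_add_left h1 _) (hH0 r y).le).trans ?_
    refine mul_le_mul_of_nonneg_right (hHD r hr y) ?_
    positivity
  have hfinal : R h * h ≤ ε * h := mul_le_mul_of_nonneg_right hRε.le hh0.le
  have hgen' := mul_le_mul_of_nonneg_left hgen hh0.le
  simp only [hR] at hfinal
  linarith

end RegularMarkovChain

/-! ### The deviation inequality -/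

/-- The Chernoff bound at its optimal parameter `log (1 + s) / u`, where `s = u * y / v`, together
with `(1 + s) * log (1 + s) - s ≥ s / 2 * log (1 + s)`. -/
theorem chernoff_exponent_le {u v y : ℝ} (hu : 0 < u) (hv : 0 < v) (hy : 0 < y) :
    -(Real.log (1 + u * y / v) / u * y) + (Real.log (1 + u * y / v) / u) ^ 2 * v *
        ((Real.exp (Real.log (1 + u * y / v)) - 1 - Real.log (1 + u * y / v)) /
          Real.log (1 + u * y / v) ^ 2) ≤
      -(y / (2 * u) * Real.log (1 + u * y / v)) := by
  set s := u * y / v with hs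
  have hs0 : 0 < s := by positivity
  have hl := Real.le_log_one_add_of_nonneg hs0.le
  rw [Real.exp_log (by linarith)]
  have hlog : 0 < Real.log (1 + s) := Real.log_pos (by linarith)
  set l := Real.log (1 + s) with hldef
  have hy' : y = s * v / u := by rw [hs]; field_simp
  rw [div_le_iff₀ (by linarith)] at hl
  have h1 : -(l / u * y) + (l / u) ^ 2 * v * ((1 + s - 1 - l) / l ^ 2) + y / (2 * u) * l =
      v / u ^ 2 * ((2 * s - l * (s + 2)) / 2) := by
    rw [hy']
    field_simp
    ring
  have h2 : v / u ^ 2 * ((2 * s - l * (s + 2)) / 2) ≤ 0 :=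
    mul_nonpos_of_nonneg_of_nonpos (by positivity) (by linarith)
  linarith

namespace RegularMarkovChain

variable {E Ω : Type*} [MetricSpace E] [MeasurableSpace E] [DiscreteMeasurableSpace E] [Countable E]
  [MeasurableSpace Ω] (𝒳 : RegularMarkovChain E Ω)

/-- The exponential moment bound for unbounded Lipschitz functions, by truncation and Fatou's
lemma. -/
theorem lintegral_exp_le {b W K : ℝ} (hb : 0 < b) (hW : 0 ≤ W) (hjumps : 𝒳.JumpsBoundedBy b)
    (hbracket : 𝒳.AngleBracketBoundedBy W) (hcurv : 𝒳.WassersteinCurvatureBoundedBelow K)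
    {f : E → ℝ} {L a β : ℝ} (hL : 0 ≤ L) (hlip : ∀ x y, |f x - f y| ≤ L * dist x y) (ha : 0 ≤ a)
    (hβ : 0 < β) {t : ℝ≥0} (ht : 0 < t) (hβL : a * (L * curvC t K) * b ≤ β) (x : E) :
    ∫⁻ ω, ENNReal.ofReal (Real.exp (a * (f (𝒳.X t ω) - 𝒳.semigroup t f x))) ∂(𝒳.law x) ≤
      ENNReal.ofReal (Real.exp
        (a ^ 2 * L ^ 2 * ((Real.exp β - 1 - β) / β ^ 2) * W * curvM t K)) := by
  have hmeas {g : E → ℝ} : Measurable fun ω => g (𝒳.X t ω) :=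
    Measurable.of_discrete.comp (𝒳.measurable_X t)
  have hint := hcurv.integrable hlip ht x
  have hmean : Tendsto (fun n => 𝒳.semigroup t (truncAt f n) x) atTop (𝓝 (𝒳.semigroup t f x)) :=
    tendsto_integral_of_dominated_convergence (fun ω => |f (𝒳.X t ω)|)
      (fun n => (hmeas (g := truncAt f n)).aestronglyMeasurable) hint.abs
      (fun n => ae_of_all _ fun ω => abs_truncAt_le_abs f n _)
      (ae_of_all _ fun ω => tendsto_truncAt f _)
  refine lintegral_le_of_tendsto_of_forall_le (F := fun n ω => ENNReal.ofReal
    (Real.exp (a * (truncAt f n (𝒳.X t ω) - 𝒳.semigroup t (truncAt f n) x))))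
    (fun n => (hmeas (g := fun z => Real.exp
      (a * (truncAt f n z - 𝒳.semigroup t (truncAt f n) x)))).ennreal_ofReal)
    (fun ω => ENNReal.tendsto_ofReal ((Real.continuous_exp.tendsto _).comp
      (((tendsto_truncAt f _).sub hmean).const_mul a))) fun n => ?_
  have hexp : ∀ z, |Real.exp (a * truncAt f n z)| ≤ Real.exp (a * n) := fun z => by
    rw [abs_of_pos (Real.exp_pos _)]
    gcongr
    exact (le_abs_self _).trans (abs_truncAt_le f n z)
  have hint' := 𝒳.integrable_of_bounded hexp t x
  have heq : ∀ ω, Real.exp (a * (truncAt f n (𝒳.X t ω) - 𝒳.semigroup t (truncAt f n) x)) =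
      Real.exp (-(a * 𝒳.semigroup t (truncAt f n) x)) * Real.exp (a * truncAt f n (𝒳.X t ω)) :=
    fun ω => by
      rw [← Real.exp_add]
      ring_nf
  simp_rw [heq]
  rw [← ofReal_integral_eq_lintegral_ofReal (hint'.const_mul _)
    (ae_of_all _ fun ω => by positivity), integral_const_mul]
  refine ENNReal.ofReal_le_ofReal ?_
  have key := 𝒳.semigroup_exp_le hb hW hjumps hbracket hcurv (abs_truncAt_le f n) hL
    (fun z z' => (abs_truncAt_sub_le f n z z').trans (hlip z z')) ha hβ ht hβL x
  refine (mul_le_mul_of_nonneg_left key (Real.exp_pos _).le).trans_eq ?_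
  rw [← Real.exp_add, neg_add_cancel_left]

theorem measureReal_le_exp {b W K : ℝ} (hb : 0 < b) (hW : 0 ≤ W) (hjumps : 𝒳.JumpsBoundedBy b)
    (hbracket : 𝒳.AngleBracketBoundedBy W) (hcurv : 𝒳.WassersteinCurvatureBoundedBelow K)
    {f : E → ℝ} {L a β : ℝ} (hL : 0 ≤ L) (hlip : ∀ x y, |f x - f y| ≤ L * dist x y) (ha : 0 ≤ a)
    (hβ : 0 < β) {t : ℝ≥0} (ht : 0 < t) (hβL : a * (L * curvC t K) * b ≤ β) (x : E) (y : ℝ) :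
    (𝒳.law x).real {ω | y ≤ f (𝒳.X t ω) - 𝒳.semigroup t f x} ≤
      Real.exp (-(a * y) +
        a ^ 2 * L ^ 2 * ((Real.exp β - 1 - β) / β ^ 2) * W * curvM t K) := by
  have hmeas : Measurable fun ω =>
      ENNReal.ofReal (Real.exp (a * (f (𝒳.X t ω) - 𝒳.semigroup t f x))) :=
    ((Measurable.of_discrete (f := fun z => Real.exp (a * (f z - 𝒳.semigroup t f x)))).comp
      (𝒳.measurable_X t)).ennreal_ofReal
  have h1 := (mul_meas_ge_le_lintegral hmeas (μ := 𝒳.law x)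
    (ENNReal.ofReal (Real.exp (a * y)))).trans
    (𝒳.lintegral_exp_le hb hW hjumps hbracket hcurv hL hlip ha hβ ht hβL x)
  have h2 : 𝒳.law x {ω | y ≤ f (𝒳.X t ω) - 𝒳.semigroup t f x} ≤
      𝒳.law x {ω | ENNReal.ofReal (Real.exp (a * y)) ≤
        ENNReal.ofReal (Real.exp (a * (f (𝒳.X t ω) - 𝒳.semigroup t f x)))} := by
    refine measure_mono fun ω hω => ENNReal.ofReal_le_ofReal (Real.exp_le_exp.2 ?_)
    exact mul_le_mul_of_nonneg_left hω ha
  have h3 := (mul_le_mul_right h2 (ENNReal.ofReal (Real.exp (a * y)))).trans h1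
  have h4 := ENNReal.toReal_mono ENNReal.ofReal_ne_top h3
  rw [ENNReal.toReal_mul, ENNReal.toReal_ofReal (Real.exp_pos _).le,
    ENNReal.toReal_ofReal (Real.exp_pos _).le, ← measureReal_def] at h4
  rw [Real.exp_add, Real.exp_neg, inv_mul_eq_div, le_div_iff₀ (Real.exp_pos _), mul_comm]
  exact h4

end RegularMarkovChain

theorem theorem3p1 {E Ω : Type*} [Countable E] [MetricSpace E] [MeasurableSpace E]
    [DiscreteMeasurableSpace E] [MeasurableSpace Ω] (𝒳 : RegularMarkovChain E Ω)
    (b V K : ℝ) (hb : 0 < b) (hV : 0 < V)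
    (hjumps : 𝒳.JumpsBoundedBy b) (hbracket : 𝒳.AngleBracketBoundedBy (V ^ 2))
    (hcurv : 𝒳.WassersteinCurvatureBoundedBelow K)
    (f : E → ℝ) (hf : IsLip f) (x : E) (t : ℝ≥0) (ht : 0 < t) (y : ℝ) (hy : 0 < y) :
    Integrable (fun ω => f (𝒳.X t ω)) (𝒳.law x) ∧
    (lipSeminorm f ≠ 0 →
      (𝒳.law x).real {ω | y ≤ f (𝒳.X t ω) - ∫ ω', f (𝒳.X t ω') ∂(𝒳.law x)} ≤
        Real.exp (-(y / (2 * b * curvC t K * (lipSeminorm f).toReal) *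
          Real.log (1 + b * curvC t K * y /
            (curvM t K * V ^ 2 * (lipSeminorm f).toReal))))) ∧
    (lipSeminorm f = 0 →
      (𝒳.law x).real {ω | y ≤ f (𝒳.X t ω) - ∫ ω', f (𝒳.X t ω') ∂(𝒳.law x)} = 0) := by
  refine ⟨hcurv.integrable hf.abs_sub_le ht x, fun hne => ?_, fun h0 => ?_⟩
  · have hL : 0 < (lipSeminorm f).toReal := ENNReal.toReal_pos hne hf.ne
    have hlip := hf.abs_sub_le
    set L := (lipSeminorm f).toReal with hLdef
    have hC : 0 < curvC t K := curvC_pos t.2 K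
    have hM : 0 < curvM t K := curvM_pos (by exact_mod_cast ht) K
    have hu : 0 < b * curvC t K * L := by positivity
    have hv : 0 < curvM t K * V ^ 2 * L ^ 2 := by positivity
    have harg : b * curvC t K * y / (curvM t K * V ^ 2 * L) =
        b * curvC t K * L * y / (curvM t K * V ^ 2 * L ^ 2) := by field_simp
    have hlog : 0 < Real.log (1 + b * curvC t K * L * y / (curvM t K * V ^ 2 * L ^ 2)) :=
      Real.log_pos (lt_add_of_pos_right 1 (by positivity))
    have hdev := 𝒳.measureReal_le_exp hb (sq_nonneg V) hjumps hbracket hcurv hL.le hlip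
      (div_pos hlog hu).le hlog ht (le_of_eq (by field_simp)) x y
    refine hdev.trans (Real.exp_le_exp.2 ?_)
    have hexpo := chernoff_exponent_le hu hv hy
    rw [harg]
    refine le_trans (le_of_eq ?_) (hexpo.trans (le_of_eq ?_)) <;> ring
  · have hconst : ∀ z, f z = f x := fun z => lipSeminorm_eq_zero_iff.1 h0 z x
    simp [hconst, not_le.2 hy]
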